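/- Let $d\ge 1$, $0<s<1$, and let $\mathcal L=-\Delta+(-\Delta)^s$ on $\mathbb R^d$. For $t>0$ let $$e^{-t\mathcal L}\varphi(x)=\int_{\mathbb R^d}P_t^s(x-y)\varphi(y)\,dy,\qquad P_t^s(x)=\frac1{(4\pi t)^{d/2}}\int_{\mathbb R^d}e^{-\frac{|x-\xi|^2}{4t}}H_t^s(\xi)\,d\xi,$$ be its heat semigroup, where $H_t^s(x)=(2\pi)^{-d}\int_{\mathbb R^d}e^{ix\cdot\xi-t|\xi|^{2s}}\,d\xi$ is the heat kernel of $-(-\Delta)^s$. Put $t_s=\max\{t^s,t\}$. For $1\le p<\infty$ let $\exp L^p(\mathbb R^d)$ be the space of real-valued $u\in L^1_{\rm loc}(\mathbb R^d)$ such that $\int_{\mathbb R^d}\big(\exp(|u|^p/\lambda^p)-1\big)\,dx<\infty$ for some $\lambda>0$, with the Luxemburg norm $$\|u\|_{\exp L^p}=\inf\Big\{\lambda>0:\int_{\mathbb R^d}\Big(\exp\Big(\frac{|u(x)|^p}{\lambda^p}\Big)-1\Big)dx\le 1\Big\}.$$ Let $\|\cdot\|_q$ be the norm of $L^q(\mathbb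 R^d)$. Then the following hold for all $1\le q\le p<\infty$ and $1\le r\le\infty$, where $C>0$ denotes constants that depend only on $d$ and $s$. In each case the integral defining $e^{-t\mathcal L}\varphi(x)$ converges absolutely for every $x$, and $e^{-t\mathcal L}\varphi\in\exp L^p(\mathbb R^d)$. 1. For all $t>0$ and $\varphi\in\exp L^p(\mathbb R^d)$, $\ \|e^{-t\mathcal L}\varphi\|_{\exp L^p}\le\|\varphi\|_{\exp L^p}$. 2. For all $t>0$ and $\varphi\in L^q(\mathbb R^d)$, $$\|e^{-t\mathcal L}\varphi\|_{\exp L^p}\le C\,t_s^{-\frac{d}{2sq}}\Big(\ln\big(t_s^{-\frac{d}{2s}}+1\big)\Big)^{-1/p}\|\varphi\|_q.$$ 3. For all $t>0$ and $\varphi\in L^r(\mathbb R^d)\cap L^q(\mathbb R^d)$, $$\|e^{-t\mathcal L}\varphi\|_{\exp L^p}\le\frac{C}{(\ln 2)^{1/p}}\Big[t_s^{-\frac{d}{2sr}}\|\varphi\|_r+\|\varphi\|_q\Big],$$ with $\frac{d}{2sr}=0$ if $r=\infty$. -/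

import Mathlib

open MeasureTheory Real
open scoped ENNReal FourierTransform

noncomputable section

/-- The exponential Orlicz modular `∫ (exp (|u x| ^ p / c ^ p) - 1) dx` over `ℝ^d`, as an element
of `[0, ∞]` (the integrand is nonnegative for `c > 0`). -/
def expModular {d : ℕ} (p : ℝ) (u : EuclideanSpace ℝ (Fin d) → ℝ) (c : ℝ) : ℝ≥0∞ :=
  ∫⁻ x, ENNReal.ofReal (exp (|u x| ^ p / c ^ p) - 1)

/-- Membership in the Orlicz space `exp L^p(ℝ^d)`: `u` is locally integrable and its modular is
finite for some scale `c > 0`. -/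
def MemExpLp {d : ℕ} (p : ℝ) (u : EuclideanSpace ℝ (Fin d) → ℝ) : Prop :=
  LocallyIntegrable u volume ∧ ∃ c : ℝ, 0 < c ∧ expModular p u c < ∞

/-- The Luxemburg norm of `exp L^p(ℝ^d)`, with values in `[0, ∞]` (the infimum of the empty set
is `∞`). -/
def expLpNorm {d : ℕ} (p : ℝ) (u : EuclideanSpace ℝ (Fin d) → ℝ) : ℝ≥0∞ :=
  sInf (ENNReal.ofReal '' {c : ℝ | 0 < c ∧ expModular p u c ≤ 1})

/-- The heat kernel `H_t^s` of `-(-Δ)^s` on `ℝ^d`, i.e. the inverse Fourier transform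
`(2π)^{-d} ∫ exp (i ⟨x, ξ⟩) exp (-t |ξ| ^ (2 s)) dξ`. The inverse transform `𝓕⁻` uses the character
`exp (2 π i ⟨x, ξ⟩)`, hence the symbol is evaluated at `2 π ξ`. The value is real
(`ofReal_fracHeatKernel`), so taking the real part loses nothing. -/
def fracHeatKernel {d : ℕ} (s t : ℝ) (x : EuclideanSpace ℝ (Fin d)) : ℝ :=
  (𝓕⁻ (fun ξ : EuclideanSpace ℝ (Fin d) ↦
    ((exp (-t * (2 * π * ‖ξ‖) ^ (2 * s)) : ℝ) : ℂ)) x).re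

theorem ofReal_fracHeatKernel {d : ℕ} (s t : ℝ) (x : EuclideanSpace ℝ (Fin d)) :
    ((fracHeatKernel s t x : ℝ) : ℂ) =
      𝓕⁻ (fun ξ : EuclideanSpace ℝ (Fin d) ↦
        ((exp (-t * (2 * π * ‖ξ‖) ^ (2 * s)) : ℝ) : ℂ)) x := by
  unfold fracHeatKernel
  rw [← Complex.conj_eq_iff_re, Real.fourierInv_eq', ← integral_conj, ← integral_neg_eq_self]
  refine integral_congr_ae (Filter.Eventually.of_forall fun ξ ↦ ?_)
  simp only [smul_eq_mul, map_mul, Complex.conj_ofReal, ← Complex.exp_conj, Complex.conj_I,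
    norm_neg, inner_neg_left]
  congr 2
  push_cast
  ring

/-- The heat kernel `P_t^s` of `L = -Δ + (-Δ)^s`: the Gaussian heat kernel convolved
with `H_t^s`. -/
def mixedHeatKernel {d : ℕ} (s t : ℝ) (x : EuclideanSpace ℝ (Fin d)) : ℝ :=
  1 / (4 * π * t) ^ ((d : ℝ) / 2) *
    ∫ ξ : EuclideanSpace ℝ (Fin d), exp (-(‖x - ξ‖ ^ 2 / (4 * t))) * fracHeatKernel s t ξ

/-- The heat semigroup `(e^{-tL} φ) x = ∫ P_t^s (x - y) φ y dy` of `L = -Δ + (-Δ)^s`. -/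
def mixedHeat {d : ℕ} (s t : ℝ) (φ : EuclideanSpace ℝ (Fin d) → ℝ)
    (x : EuclideanSpace ℝ (Fin d)) : ℝ :=
  ∫ y : EuclideanSpace ℝ (Fin d), mixedHeatKernel s t (x - y) * φ y

/-- The integral that defines `e^{-tL} φ` converges absolutely at every point. -/
def MixedHeatConverges {d : ℕ} (s t : ℝ) (φ : EuclideanSpace ℝ (Fin d) → ℝ) : Prop :=
  ∀ x : EuclideanSpace ℝ (Fin d),
    Integrable (fun y : EuclideanSpace ℝ (Fin d) ↦ mixedHeatKernel s t (x - y) * φ y) volume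

/-- `t_s = max {t^s, t}`. -/
def mixedTime (s t : ℝ) : ℝ := max (t ^ s) t

end

/-!
The kernel `P_t` of `-Δ + (-Δ)^s` is treated as the inverse Fourier transform of the symbol
`exp (-t (|2πξ|² + |2πξ|^(2s)))`. Everything follows from four properties of it: `P_t` is
continuous, nonnegative, has integral one, and satisfies `P_t ≤ A t_s ^ (-d/(2s))` (`IsBoundedDensity`).

*Positivity* is a form of subordination. Call a bounded function `m` on `[0, ∞)` Gauss-positive if
`exp (-τ|ξ|²) m(|ξ|²)` has a nonnegative inverse Fourier transform for every `τ > 0`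
(`IsGaussPos`). Since Gaussians transform to Gaussians, constants are Gauss-positive, and the class
is stable under multiplication by `exp (-u r)` with `u ≥ 0`, hence by Laplace transforms of finite
positive weights, under sums and bounded pointwise limits, and therefore contains the exponentials
of such Laplace transforms. Up to a positive constant `r^s` is `∫ (1 - exp (-r u)) u^(-1-s) du`, and
cutting this integral off at `u > 1/(n+1)` exhibits `exp (-a r^s)` as a limit of positive multiples
of such exponentials (`IsGaussPos.exp_neg_mul_rpow`). The Gaussian factor that the definition asks
for is supplied by the local part `-Δ`, so positivity of the fractional kernel itself is not needed.

*Mass one.* A nonnegative function with a Fourier transform bounded by `1` has mass at most `1`, as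
seen by pairing it with wide Gaussians; Fourier inversion at the origin then gives mass exactly `1`.

*Size.* The kernel is bounded by the integral of the symbol, and dropping either of the two factors
of the symbol gives, by scaling, the two powers of `t` whose minimum is `t_s ^ (-d/(2s))`.

For such a density, Jensen's inequality yields `∫ Φ(P * φ) ≤ ∫ Φ(φ)` and `Φ(P * φ) ≤ K ∫ Φ(φ)` for
convex `Φ ≥ 0`. With `Φ(z) = exp (|z|^p / c^p) - 1` this is the contraction property; with
`Φ(z) = |z|^q` it controls `u = P * φ` in `L^q` and in `L^∞`. These two bounds suffice for the
modular: if `|u| ≤ M` and `q ≤ p`, convexity of `exp` gives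
`exp (|u|^p / c^p) - 1 ≤ (|u| / M)^q (exp ((M / c)^p) - 1)`, so that no expansion of the exponential
into a series is required (`expModular_le_one_of_abs_le`).
-/

section

open Filter Topology Set

/-! ### Radial multipliers with nonnegative Gaussian-regularised kernels -/

/-- A radial multiplier `ξ ↦ m (‖ξ‖ ^ 2)` all of whose Gaussian regularisations
`exp (-τ ‖ξ‖ ^ 2) * m (‖ξ‖ ^ 2)`, `τ > 0`, have a nonnegative inverse Fourier transform on `ℝ^d`.
The transform of such an even real function is written as a cosine integral; only the values of `m`
on `[0, ∞)` enter the bound and the integral. -/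
structure IsGaussPos (d : ℕ) (m : ℝ → ℝ) : Prop where
  measurable : Measurable m
  bounded : ∃ B : ℝ, ∀ r, 0 ≤ r → |m r| ≤ B
  nonneg : ∀ τ : ℝ, 0 < τ → ∀ x : EuclideanSpace ℝ (Fin d),
    0 ≤ ∫ ξ : EuclideanSpace ℝ (Fin d),
      cos (2 * π * inner ℝ ξ x) * exp (-τ * ‖ξ‖ ^ 2) * m (‖ξ‖ ^ 2)

theorem integrable_exp_neg_mul_sq_norm {d : ℕ} {τ : ℝ} (hτ : 0 < τ) :
    Integrable fun ξ : EuclideanSpace ℝ (Fin d) ↦ exp (-τ * ‖ξ‖ ^ 2) := by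
  have h := (GaussianFourier.integrable_cexp_neg_mul_sq_norm_add
    (V := EuclideanSpace ℝ (Fin d)) (b := τ) (by simpa using hτ) 0 0).norm
  refine h.congr (Eventually.of_forall fun ξ ↦ ?_)
  simp only [Complex.norm_exp]
  congr 1
  simp [← Complex.ofReal_pow]

theorem integrable_gaussian_mul {d : ℕ} {τ : ℝ} (hτ : 0 < τ) {m : ℝ → ℝ} (hm : Measurable m)
    {B : ℝ} (hB : ∀ r, 0 ≤ r → |m r| ≤ B) (x : EuclideanSpace ℝ (Fin d)) :
    Integrable fun ξ : EuclideanSpace ℝ (Fin d) ↦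
      cos (2 * π * inner ℝ ξ x) * exp (-τ * ‖ξ‖ ^ 2) * m (‖ξ‖ ^ 2) := by
  refine ((integrable_exp_neg_mul_sq_norm hτ).mul_const B).mono' (by fun_prop)
    (Eventually.of_forall fun ξ ↦ ?_)
  rw [norm_mul, norm_mul, Real.norm_eq_abs, Real.norm_eq_abs, Real.norm_eq_abs, abs_exp]
  calc _ ≤ 1 * exp (-τ * ‖ξ‖ ^ 2) * B := by
        gcongr
        · exact abs_cos_le_one _
        · exact hB _ (by positivity)
    _ = _ := by ring

theorem integral_cos_mul_gaussian {d : ℕ} {τ : ℝ} (hτ : 0 < τ) (x : EuclideanSpace ℝ (Fin d)) :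
    ∫ ξ : EuclideanSpace ℝ (Fin d), cos (2 * π * inner ℝ ξ x) * exp (-τ * ‖ξ‖ ^ 2) =
      (π / τ) ^ ((d : ℝ) / 2) * exp (-π ^ 2 * ‖x‖ ^ 2 / τ) := by
  have h := fourier_gaussian_innerProductSpace (V := EuclideanSpace ℝ (Fin d)) (b := τ)
    (by simpa using hτ) x
  have h1 := congrArg Complex.re h
  rw [Real.fourier_eq'] at h1
  have h2 : Integrable fun v : EuclideanSpace ℝ (Fin d) ↦
      Complex.exp (↑(-2 * π * inner ℝ v x) * Complex.I) • Complex.exp (-↑τ * (‖v‖ : ℂ) ^ 2) := by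
    refine (integrable_exp_neg_mul_sq_norm (d := d) hτ).mono' (by fun_prop)
      (Eventually.of_forall fun ξ ↦ ?_)
    rw [norm_smul, Complex.norm_exp_ofReal_mul_I, Complex.norm_exp, one_mul]
    simp [← Complex.ofReal_pow]
  have h3 := integral_re (𝕜 := ℂ) h2
  simp only [RCLike.re_to_complex] at h3
  rw [← h3] at h1
  convert h1 using 1
  · refine integral_congr_ae (Eventually.of_forall fun ξ ↦ ?_)
    simp only [smul_eq_mul]
    rw [show Complex.exp (-↑τ * (‖ξ‖ : ℂ) ^ 2) = ((exp (-τ * ‖ξ‖ ^ 2) : ℝ) : ℂ) by push_cast; rfl,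
      Complex.re_mul_ofReal, Complex.exp_ofReal_mul_I_re]
    rw [show -2 * π * inner ℝ ξ x = -(2 * π * inner ℝ ξ x) by ring, cos_neg]
  · rw [show (-(π : ℂ) ^ 2 * (‖x‖ : ℂ) ^ 2 / τ) = ((-π ^ 2 * ‖x‖ ^ 2 / τ : ℝ) : ℂ) by
        push_cast; rfl,
      ← Complex.ofReal_exp, Complex.re_mul_ofReal]
    congr 1
    simp only [finrank_euclideanSpace, Fintype.card_fin]
    rw [show ((d : ℂ) / 2) = (((d : ℝ) / 2 : ℝ) : ℂ) by push_cast; rfl, ← Complex.ofReal_div,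
      ← Complex.ofReal_cpow (by positivity), Complex.ofReal_re]

namespace IsGaussPos
variable {d : ℕ} {m m' : ℝ → ℝ}

theorem const {a : ℝ} (ha : 0 ≤ a) : IsGaussPos d fun _ ↦ a where
  measurable := measurable_const
  bounded := ⟨|a|, fun _ _ ↦ le_rfl⟩
  nonneg τ hτ x := by
    rw [integral_mul_const, integral_cos_mul_gaussian hτ]
    positivity

theorem add (h : IsGaussPos d m) (h' : IsGaussPos d m') : IsGaussPos d fun r ↦ m r + m' r where
  measurable := h.measurable.add h'.measurable
  bounded := by
    obtain ⟨B, hB⟩ := h.bounded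
    obtain ⟨B', hB'⟩ := h'.bounded
    exact ⟨B + B', fun r hr ↦ (abs_add_le _ _).trans (add_le_add (hB r hr) (hB' r hr))⟩
  nonneg τ hτ x := by
    obtain ⟨B, hB⟩ := h.bounded
    obtain ⟨B', hB'⟩ := h'.bounded
    simp only [mul_add]
    rw [integral_add (integrable_gaussian_mul hτ h.measurable hB x)
      (integrable_gaussian_mul hτ h'.measurable hB' x)]
    exact add_nonneg (h.nonneg τ hτ x) (h'.nonneg τ hτ x)

theorem const_mul (h : IsGaussPos d m) {a : ℝ} (ha : 0 ≤ a) : IsGaussPos d fun r ↦ a * m r where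
  measurable := h.measurable.const_mul a
  bounded := by
    obtain ⟨B, hB⟩ := h.bounded
    refine ⟨a * B, fun r hr ↦ ?_⟩
    rw [abs_mul, abs_of_nonneg ha]
    exact mul_le_mul_of_nonneg_left (hB r hr) ha
  nonneg τ hτ x := by
    simp only [mul_left_comm _ a]
    rw [integral_const_mul]
    exact mul_nonneg ha (h.nonneg τ hτ x)

/-- Multiplication by `exp (-u r)` only replaces the Gaussian parameter `τ` by `τ + u`. -/
theorem exp_mul (h : IsGaussPos d m) {u : ℝ} (hu : 0 ≤ u) :
    IsGaussPos d fun r ↦ exp (-(r * u)) * m r where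
  measurable := by have := h.measurable; fun_prop
  bounded := by
    obtain ⟨B, hB⟩ := h.bounded
    refine ⟨B, fun r hr ↦ ?_⟩
    rw [abs_mul, abs_exp]
    refine (mul_le_of_le_one_left (abs_nonneg _) ?_).trans (hB r hr)
    rw [exp_le_one_iff]
    nlinarith [mul_nonneg hr hu]
  nonneg τ hτ x := by
    convert h.nonneg (τ + u) (by linarith) x using 3 with ξ
    rw [← mul_assoc, mul_assoc (cos _), ← exp_add]
    congr 3
    ring

/-- Stability under uniformly bounded pointwise limits. -/
theorem of_tendsto {F : ℕ → ℝ → ℝ} (hF : ∀ n, IsGaussPos d (F n)) {B : ℝ}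
    (hB : ∀ n r, 0 ≤ r → |F n r| ≤ B) (hm : Measurable m)
    (hlim : ∀ r, 0 ≤ r → Tendsto (fun n ↦ F n r) atTop (𝓝 (m r))) : IsGaussPos d m where
  measurable := hm
  bounded := ⟨B, fun r hr ↦ le_of_tendsto (hlim r hr).abs (Eventually.of_forall fun n ↦ hB n r hr)⟩
  nonneg τ hτ x := by
    refine ge_of_tendsto' (tendsto_integral_of_dominated_convergence
      (fun ξ : EuclideanSpace ℝ (Fin d) ↦ exp (-τ * ‖ξ‖ ^ 2) * B)
      (fun n ↦ (integrable_gaussian_mul hτ (hF n).measurable (hB n) x).aestronglyMeasurable)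
      ((integrable_exp_neg_mul_sq_norm hτ).mul_const B)
      (fun n ↦ Eventually.of_forall fun ξ ↦ ?_)
      (Eventually.of_forall fun ξ ↦ (hlim _ (by positivity)).const_mul _))
      (fun n ↦ (hF n).nonneg τ hτ x)
    rw [norm_mul, norm_mul, Real.norm_eq_abs, Real.norm_eq_abs, Real.norm_eq_abs, abs_exp]
    calc _ ≤ 1 * exp (-τ * ‖ξ‖ ^ 2) * B := by
          gcongr
          · exact abs_cos_le_one _
          · exact hB n _ (by positivity)
      _ = _ := by ring

/-- Stability under multiplication by the Laplace transform of a nonnegative integrable weight on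
`(ε, ∞)`: by Fubini, the kernel is a superposition of those given by `IsGaussPos.exp_mul`. -/
theorem laplace_mul (h : IsGaussPos d m) {w : ℝ → ℝ} {ε : ℝ} (hε : 0 ≤ ε)
    (hw : ∀ u ∈ Ioi ε, 0 ≤ w u) (hwi : IntegrableOn w (Ioi ε)) :
    IsGaussPos d fun r ↦ (∫ u in Ioi ε, exp (-(r * u)) * w u) * m r := by
  obtain ⟨B, hB⟩ := h.bounded
  have hm := h.measurable
  have hle : ∀ r, 0 ≤ r → ∀ u ∈ Ioi ε, ‖exp (-(r * u)) * w u‖ ≤ w u := by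
    intro r hr u hu
    rw [norm_mul, Real.norm_eq_abs, abs_exp, Real.norm_of_nonneg (hw u hu)]
    refine mul_le_of_le_one_left (hw u hu) ?_
    rw [exp_le_one_iff]
    nlinarith [mul_nonneg hr (hε.trans (le_of_lt hu))]
  refine ⟨?_, ⟨(∫ u in Ioi ε, w u) * B, fun r hr ↦ ?_⟩, fun τ hτ x ↦ ?_⟩
  · refine Measurable.mul ?_ hm
    have : AEStronglyMeasurable w (volume.restrict (Ioi ε)) := hwi.aestronglyMeasurable
    have e : (fun r : ℝ ↦ ∫ u in Ioi ε, exp (-(r * u)) * w u) =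
        fun r ↦ ∫ u in Ioi ε, exp (-(r * u)) * this.mk w u := by
      ext r
      refine integral_congr_ae ?_
      filter_upwards [this.ae_eq_mk] with u hu
      rw [hu]
    rw [e]
    refine StronglyMeasurable.measurable (StronglyMeasurable.integral_prod_right
      (f := fun r u ↦ exp (-(r * u)) * this.mk w u) ?_)
    refine StronglyMeasurable.mul (by fun_prop)
      (this.stronglyMeasurable_mk.comp_measurable measurable_snd)
  · rw [abs_mul]
    refine mul_le_mul ?_ (hB r hr) (abs_nonneg _) (setIntegral_nonneg measurableSet_Ioi hw)
    rw [← Real.norm_eq_abs]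
    refine norm_integral_le_of_norm_le hwi ?_
    exact (ae_restrict_iff' measurableSet_Ioi).2 (Eventually.of_forall (hle r hr))
  · have e : ∀ ξ : EuclideanSpace ℝ (Fin d),
        cos (2 * π * inner ℝ ξ x) * exp (-τ * ‖ξ‖ ^ 2) *
          ((∫ u in Ioi ε, exp (-(‖ξ‖ ^ 2 * u)) * w u) * m (‖ξ‖ ^ 2)) =
        ∫ u in Ioi ε, (cos (2 * π * inner ℝ ξ x) * exp (-τ * ‖ξ‖ ^ 2) *
          (exp (-(‖ξ‖ ^ 2 * u)) * m (‖ξ‖ ^ 2))) * w u := by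
      intro ξ
      rw [← integral_mul_const, ← integral_const_mul]
      congr 1 with u
      ring
    simp only [e]
    rw [integral_integral_swap]
    · refine setIntegral_nonneg measurableSet_Ioi fun u hu ↦ ?_
      rw [integral_mul_const]
      exact mul_nonneg ((h.exp_mul (hε.trans (le_of_lt hu))).nonneg τ hτ x) (hw u hu)
    · have h1 : Integrable (fun z : EuclideanSpace ℝ (Fin d) × ℝ ↦
          (exp (-τ * ‖z.1‖ ^ 2) * B) * w z.2) (volume.prod (volume.restrict (Ioi ε))) :=
        ((integrable_exp_neg_mul_sq_norm hτ).mul_const B).mul_prod hwi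
      refine h1.mono ?_ ?_
      · refine AEStronglyMeasurable.mul ?_ hwi.aestronglyMeasurable.comp_snd
        exact Measurable.aestronglyMeasurable (by fun_prop)
      · have hae : ∀ᵐ z ∂((volume : Measure (EuclideanSpace ℝ (Fin d))).prod
            (volume.restrict (Ioi ε))), z.2 ∈ Ioi ε := by
          refine Measure.quasiMeasurePreserving_snd.ae ?_
          exact ae_restrict_mem measurableSet_Ioi
        filter_upwards [hae] with z hz
        have hB0 : 0 ≤ B := (abs_nonneg _).trans (hB 0 le_rfl)
        simp only [Function.uncurry, norm_mul, Real.norm_eq_abs, abs_exp]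
        have h2 : exp (-(‖z.1‖ ^ 2 * z.2)) ≤ 1 := by
          rw [exp_le_one_iff]
          have : 0 ≤ ‖z.1‖ ^ 2 * z.2 := mul_nonneg (by positivity) (hε.trans (le_of_lt hz))
          linarith
        calc _ ≤ 1 * exp (-τ * ‖z.1‖ ^ 2) * (1 * B) * |w z.2| := by
              gcongr
              · exact abs_cos_le_one _
              · exact hB _ (by positivity)
          _ = _ := by rw [abs_of_nonneg hB0]; ring

/-- If multiplication by a bounded nonnegative `φ` preserves Gauss-positivity, then `exp φ` is
Gauss-positive, being the bounded limit of `(1 + φ / n) ^ n`. -/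
theorem exp_of_mul {φ : ℝ → ℝ} (hφ : ∀ m, IsGaussPos d m → IsGaussPos d fun r ↦ φ r * m r)
    {B : ℝ} (h0 : ∀ r, 0 ≤ r → 0 ≤ φ r) (hB : ∀ r, 0 ≤ r → φ r ≤ B) :
    IsGaussPos d fun r ↦ exp (φ r) := by
  have hφm : Measurable φ := by simpa using (hφ _ (const zero_le_one)).measurable
  have hpow : ∀ n k : ℕ, IsGaussPos d fun r ↦ (1 + φ r / n) ^ k := by
    intro n k
    induction k with
    | zero => simpa using const zero_le_one
    | succ k ih =>
      convert ih.add ((hφ _ ih).const_mul (a := (n : ℝ)⁻¹) (by positivity)) using 2 with r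
      ring
  refine of_tendsto (fun n ↦ hpow n n) (B := exp B) (fun n r hr ↦ ?_) (by fun_prop)
    (fun r _ ↦ tendsto_one_add_div_pow_exp (φ r))
  have h1 : 0 ≤ φ r / n := div_nonneg (h0 r hr) (by positivity)
  rw [abs_of_nonneg (by positivity)]
  refine le_trans ?_ (exp_le_exp.2 (hB r hr))
  rcases Nat.eq_zero_or_pos n with rfl | hn
  · simpa using h0 r hr
  · calc (1 + φ r / n) ^ n ≤ (exp (φ r / n)) ^ n := by
          gcongr
          linarith [add_one_le_exp (φ r / n)]
      _ = exp (φ r) := by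
          rw [← exp_nat_mul]
          congr 1
          field_simp

end IsGaussPos

/-! ### The fractional power as an integral of exponentials -/

theorem integrableOn_one_sub_exp_neg_mul_rpow {s : ℝ} (hs0 : 0 < s) (hs1 : s < 1) :
    IntegrableOn (fun u : ℝ ↦ (1 - exp (-u)) * u ^ (-1 - s)) (Ioi 0) := by
  have hmeas : Measurable fun u : ℝ ↦ (1 - exp (-u)) * u ^ (-1 - s) := by fun_prop
  rw [← Ioc_union_Ioi_eq_Ioi zero_le_one]
  refine IntegrableOn.union ?_ ?_
  · have h := (intervalIntegral.intervalIntegrable_rpow' (a := 0) (b := 1) (r := -s)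
      (by linarith))
    rw [intervalIntegrable_iff_integrableOn_Ioc_of_le zero_le_one] at h
    refine Integrable.mono' h hmeas.aestronglyMeasurable
      ((ae_restrict_iff' measurableSet_Ioc).2 (Eventually.of_forall fun u hu ↦ ?_))
    have hu0 : 0 < u := hu.1
    rw [Real.norm_of_nonneg (mul_nonneg (by simp [hu0.le]) (by positivity)),
      show -s = 1 + (-1 - s) by ring, rpow_add hu0, rpow_one]
    gcongr
    linarith [add_one_le_exp (-u)]
  · refine Integrable.mono' (integrableOn_Ioi_rpow_of_lt (a := -1 - s) (by linarith) zero_lt_one)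
      hmeas.aestronglyMeasurable
      ((ae_restrict_iff' measurableSet_Ioi).2 (Eventually.of_forall fun u hu ↦ ?_))
    have hu0 : 0 < u := zero_lt_one.trans hu
    rw [Real.norm_of_nonneg (mul_nonneg (by simp [hu0.le]) (by positivity))]
    exact mul_le_of_le_one_left (by positivity) (by linarith [exp_pos (-u)])

theorem one_sub_exp_neg_mul_eq {s r u : ℝ} (hr : 0 < r) (hu : 0 < u) :
    (1 - exp (-(r * u))) * u ^ (-1 - s) =
      r ^ (1 + s) * ((1 - exp (-(r * u))) * (r * u) ^ (-1 - s)) := by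
  rw [mul_rpow hr.le hu.le, mul_left_comm (1 - _), ← mul_assoc (r ^ _), ← rpow_add hr]
  norm_num

theorem integrableOn_one_sub_exp_neg_mul_mul_rpow {s : ℝ} (hs0 : 0 < s) (hs1 : s < 1) {r : ℝ}
    (hr : 0 ≤ r) : IntegrableOn (fun u : ℝ ↦ (1 - exp (-(r * u))) * u ^ (-1 - s)) (Ioi 0) := by
  rcases hr.eq_or_lt with rfl | hr
  · simp
  · have h := (integrableOn_Ioi_comp_mul_left_iff
      (fun u : ℝ ↦ (1 - exp (-u)) * u ^ (-1 - s)) 0 hr).2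
      (by simpa using integrableOn_one_sub_exp_neg_mul_rpow hs0 hs1)
    exact IntegrableOn.congr_fun (h.const_mul (r ^ (1 + s)))
      (fun u hu ↦ (one_sub_exp_neg_mul_eq hr hu).symm) measurableSet_Ioi

/-- The Lévy–Khintchine representation of `r ^ s`, up to the positive constant
`∫ (1 - exp (-u)) u ^ (-1 - s) du`. -/
theorem integral_one_sub_exp_neg_mul_mul_rpow {s : ℝ} (hs0 : 0 < s) {r : ℝ} (hr : 0 ≤ r) :
    ∫ u in Ioi 0, (1 - exp (-(r * u))) * u ^ (-1 - s) =
      r ^ s * ∫ u in Ioi 0, (1 - exp (-u)) * u ^ (-1 - s) := by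
  rcases hr.eq_or_lt with rfl | hr
  · simp [zero_rpow hs0.ne']
  · rw [setIntegral_congr_fun measurableSet_Ioi fun u hu ↦ one_sub_exp_neg_mul_eq hr hu,
      integral_const_mul,
      integral_comp_mul_left_Ioi (fun u : ℝ ↦ (1 - exp (-u)) * u ^ (-1 - s)) 0 hr, mul_zero,
      smul_eq_mul, ← mul_assoc, add_comm, rpow_add_one hr.ne', mul_inv_cancel_right₀ hr.ne']

theorem integral_one_sub_exp_neg_mul_rpow_pos {s : ℝ} (hs0 : 0 < s) (hs1 : s < 1) :
    0 < ∫ u in Ioi 0, (1 - exp (-u)) * u ^ (-1 - s) := by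
  have hpos : ∀ u ∈ Ioi (0 : ℝ), 0 < (1 - exp (-u)) * u ^ (-1 - s) := fun u hu ↦
    mul_pos (by simpa using hu) (rpow_pos_of_pos hu _)
  rw [setIntegral_pos_iff_support_of_nonneg_ae
    ((ae_restrict_iff' measurableSet_Ioi).2 (Eventually.of_forall fun u hu ↦ (hpos u hu).le))
    (integrableOn_one_sub_exp_neg_mul_rpow hs0 hs1),
    inter_eq_right.2 fun u hu ↦ Function.mem_support.2 (hpos u hu).ne']
  simp

namespace IsGaussPos

/-- The key positivity statement, the analytic counterpart of subordination for the fractional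
Laplacian. -/
theorem exp_neg_mul_rpow (d : ℕ) {s a : ℝ} (hs0 : 0 < s) (hs1 : s < 1) (ha : 0 ≤ a) :
    IsGaussPos d fun r ↦ exp (-(a * r ^ s)) := by
  set c := ∫ u in Ioi 0, (1 - exp (-u)) * u ^ (-1 - s) with hc
  have hc0 : 0 < c := integral_one_sub_exp_neg_mul_rpow_pos hs0 hs1
  -- The weight `u ^ (-1 - s)` is integrable only away from `0`, hence the cut-off at `1 / (n + 1)`.
  have hε : ∀ n : ℕ, (0 : ℝ) < 1 / (n + 1) := fun n ↦ by positivity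
  have hpow : ∀ n : ℕ, IntegrableOn (fun u : ℝ ↦ u ^ (-1 - s)) (Ioi (1 / (n + 1))) := fun n ↦
    integrableOn_Ioi_rpow_of_lt (by linarith) (hε n)
  have hw0 : ∀ n : ℕ, ∀ u ∈ Ioi ((1 : ℝ) / (n + 1)), 0 ≤ a / c * u ^ (-1 - s) := fun n u hu ↦ by
    have : 0 < u := (hε n).trans hu
    positivity
  have hle : ∀ (n : ℕ) (r : ℝ), 0 ≤ r → ∀ u ∈ Ioi ((1 : ℝ) / (n + 1)),
      exp (-(r * u)) * (a / c * u ^ (-1 - s)) ≤ a / c * u ^ (-1 - s) := fun n r hr u hu ↦ by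
    refine mul_le_of_le_one_left (hw0 n u hu) ?_
    rw [exp_le_one_iff]
    nlinarith [mul_nonneg hr ((hε n).trans hu).le]
  have hexpi : ∀ (n : ℕ) (r : ℝ), 0 ≤ r → IntegrableOn
      (fun u ↦ exp (-(r * u)) * (a / c * u ^ (-1 - s))) (Ioi (1 / (n + 1))) := fun n r hr ↦ by
    refine Integrable.mono' ((hpow n).const_mul (a / c))
      (Measurable.aestronglyMeasurable (by fun_prop))
      ((ae_restrict_iff' measurableSet_Ioi).2 (Eventually.of_forall fun u hu ↦ ?_))
    rw [Real.norm_of_nonneg (mul_nonneg (exp_pos _).le (hw0 n u hu))]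
    exact hle n r hr u hu
  have hkey : ∀ n : ℕ, IsGaussPos d fun r ↦ exp (∫ u in Ioi ((1 : ℝ) / (n + 1)),
      exp (-(r * u)) * (a / c * u ^ (-1 - s))) := fun n ↦ by
    refine exp_of_mul (B := ∫ u in Ioi ((1 : ℝ) / (n + 1)), a / c * u ^ (-1 - s))
      (fun m hm ↦ hm.laplace_mul (hε n).le (hw0 n) ((hpow n).const_mul _)) (fun r hr ↦ ?_)
      (fun r hr ↦ ?_)
    · exact setIntegral_nonneg measurableSet_Ioi fun u hu ↦ mul_nonneg (exp_pos _).le (hw0 n u hu)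
    · exact setIntegral_mono_on (hexpi n r hr) ((hpow n).const_mul _) measurableSet_Ioi
        (hle n r hr)
  have hF : ∀ n : ℕ, IsGaussPos d fun r ↦
      exp (-∫ u in Ioi ((1 : ℝ) / (n + 1)), a / c * u ^ (-1 - s)) *
      exp (∫ u in Ioi ((1 : ℝ) / (n + 1)), exp (-(r * u)) * (a / c * u ^ (-1 - s))) := fun n ↦
    (hkey n).const_mul (exp_pos _).le
  have heq : ∀ (n : ℕ) (r : ℝ), 0 ≤ r →
      exp (-∫ u in Ioi ((1 : ℝ) / (n + 1)), a / c * u ^ (-1 - s)) *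
      exp (∫ u in Ioi ((1 : ℝ) / (n + 1)), exp (-(r * u)) * (a / c * u ^ (-1 - s))) =
      exp (-(a / c * ∫ u in Ioi ((1 : ℝ) / (n + 1)), (1 - exp (-(r * u))) * u ^ (-1 - s))) :=
    fun n r hr ↦ by
      rw [← exp_add, neg_add_eq_sub, ← integral_sub (hexpi n r hr) ((hpow n).const_mul _),
        ← integral_const_mul, ← integral_neg]
      congr 2 with u
      ring
  refine of_tendsto hF (B := 1) (fun n r hr ↦ ?_) (by fun_prop) (fun r hr ↦ ?_)
  · rw [heq n r hr, abs_exp, exp_le_one_iff, neg_nonpos]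
    refine mul_nonneg (by positivity) (setIntegral_nonneg measurableSet_Ioi fun u hu ↦ ?_)
    have hu0 : 0 < u := (hε n).trans hu
    refine mul_nonneg ?_ (by positivity)
    rw [sub_nonneg, exp_le_one_iff, neg_nonpos]
    positivity
  · simp only [heq _ r hr]
    have h1 : Tendsto (fun n : ℕ ↦ ∫ u in Ioi ((1 : ℝ) / (n + 1)),
        (1 - exp (-(r * u))) * u ^ (-1 - s)) atTop (𝓝 (r ^ s * c)) := by
      rw [hc, ← integral_one_sub_exp_neg_mul_mul_rpow hs0 hr]
      have hcov := aecover_Ioi_of_Ioi (μ := volume) (A := (0 : ℝ))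
        (l := atTop) (a := fun n : ℕ ↦ (1 : ℝ) / (n + 1)) tendsto_one_div_add_atTop_nhds_zero_nat
      have := hcov.integral_tendsto_of_countably_generated
        (integrableOn_one_sub_exp_neg_mul_mul_rpow hs0 hs1 hr)
      refine this.congr fun n ↦ ?_
      rw [Measure.restrict_restrict measurableSet_Ioi, inter_eq_left.2 (Ioi_subset_Ioi (hε n).le)]
    rw [show a * r ^ s = a / c * (r ^ s * c) by field_simp]
    exact (continuous_exp.tendsto _).comp (h1.const_mul (a / c)).neg

end IsGaussPos

variable {d : ℕ}

/-! ### Fourier symbol of the mixed heat kernel -/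

theorem integrable_exp_neg_mul_norm_rpow (hd : 1 ≤ d) {t α : ℝ} (ht : 0 < t) (hα : 0 < α) :
    Integrable fun ξ : EuclideanSpace ℝ (Fin d) ↦ exp (-t * (2 * π * ‖ξ‖) ^ α) := by
  have : Nonempty (Fin d) := ⟨⟨0, hd⟩⟩
  rw [integrable_fun_norm_addHaar volume (f := fun y : ℝ ↦ exp (-t * (2 * π * y) ^ α))]
  have h := integrableOn_rpow_mul_exp_neg_mul_rpow (s := (d : ℝ) - 1) (p := α)
    (b := t * (2 * π) ^ α) (by have : (1 : ℝ) ≤ d := by exact_mod_cast hd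
                               linarith) hα (by positivity)
  refine h.congr_fun (fun y hy ↦ ?_) measurableSet_Ioi
  have hy0 : 0 < y := hy
  simp only [finrank_euclideanSpace, Fintype.card_fin, smul_eq_mul]
  rw [← rpow_natCast, Nat.cast_sub hd, Nat.cast_one, mul_rpow (by positivity) hy0.le]
  congr 2
  ring

/-- The power of `t` comes from the substitution `ξ ↦ t ^ (1 / α) • ξ`. -/
theorem integral_exp_neg_mul_norm_rpow {t α : ℝ} (ht : 0 < t) (hα : 0 < α) :
    ∫ ξ : EuclideanSpace ℝ (Fin d), exp (-t * (2 * π * ‖ξ‖) ^ α) =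
      t ^ (-((d : ℝ) / α)) * ∫ ξ : EuclideanSpace ℝ (Fin d), exp (-(2 * π * ‖ξ‖) ^ α) := by
  have h := Measure.integral_comp_smul_of_nonneg volume
    (fun ξ : EuclideanSpace ℝ (Fin d) ↦ exp (-(2 * π * ‖ξ‖) ^ α)) (t ^ (1 / α))
    (hR := by positivity)
  simp only [finrank_euclideanSpace, Fintype.card_fin, smul_eq_mul] at h
  rw [← rpow_natCast, ← rpow_mul ht.le, ← rpow_neg ht.le,
    show -(1 / α * (d : ℝ)) = -((d : ℝ) / α) by ring] at h
  rw [← h]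
  congr 1 with ξ
  have e : (t ^ (1 / α) * (2 * π * ‖ξ‖)) ^ α = t * (2 * π * ‖ξ‖) ^ α := by
    rw [mul_rpow (by positivity) (by positivity), ← rpow_mul ht.le, one_div_mul_cancel hα.ne',
      rpow_one]
  rw [norm_smul, Real.norm_of_nonneg (by positivity), mul_left_comm, e, neg_mul]

/-- The Fourier symbol `exp (-t (|2πξ| ^ 2 + |2πξ| ^ (2s)))` of `e^{-tL}`, in the normalisation of
`𝓕` with character `exp (2πi⟨x, ξ⟩)`; the Gaussian factor is kept separate, in the form used by
`IsGaussPos`. -/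
noncomputable def mixedSymbol (s t : ℝ) (ξ : EuclideanSpace ℝ (Fin d)) : ℝ :=
  exp (-(4 * π ^ 2 * t) * ‖ξ‖ ^ 2) * exp (-t * (2 * π * ‖ξ‖) ^ (2 * s))

theorem mixedSymbol_nonneg (s t : ℝ) (ξ : EuclideanSpace ℝ (Fin d)) : 0 ≤ mixedSymbol s t ξ :=
  mul_nonneg (exp_pos _).le (exp_pos _).le

theorem exp_neg_mul_rpow_le_one {t : ℝ} (ht : 0 ≤ t) (α : ℝ) (ξ : EuclideanSpace ℝ (Fin d)) :
    exp (-t * (2 * π * ‖ξ‖) ^ α) ≤ 1 := by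
  rw [exp_le_one_iff, neg_mul, neg_nonpos]
  positivity

theorem mixedSymbol_le_gaussian (s : ℝ) {t : ℝ} (ht : 0 ≤ t) (ξ : EuclideanSpace ℝ (Fin d)) :
    mixedSymbol s t ξ ≤ exp (-(4 * π ^ 2 * t) * ‖ξ‖ ^ 2) :=
  mul_le_of_le_one_right (exp_pos _).le (exp_neg_mul_rpow_le_one ht _ ξ)

theorem mixedSymbol_le_exp_rpow (s : ℝ) {t : ℝ} (ht : 0 ≤ t) (ξ : EuclideanSpace ℝ (Fin d)) :
    mixedSymbol s t ξ ≤ exp (-t * (2 * π * ‖ξ‖) ^ (2 * s)) := by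
  refine mul_le_of_le_one_left (exp_pos _).le ?_
  rw [exp_le_one_iff, neg_mul, neg_nonpos]
  positivity

theorem mixedSymbol_le_one (s : ℝ) {t : ℝ} (ht : 0 ≤ t) (ξ : EuclideanSpace ℝ (Fin d)) :
    mixedSymbol s t ξ ≤ 1 :=
  (mixedSymbol_le_exp_rpow s ht ξ).trans (exp_neg_mul_rpow_le_one ht _ ξ)

theorem continuous_mixedSymbol {s : ℝ} (hs : 0 < s) (t : ℝ) :
    Continuous (mixedSymbol (d := d) s t) := by
  unfold mixedSymbol
  refine Continuous.mul (by fun_prop) (continuous_exp.comp (continuous_const.mul ?_))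
  exact (by fun_prop : Continuous fun ξ : EuclideanSpace ℝ (Fin d) ↦ 2 * π * ‖ξ‖).rpow_const
    fun _ ↦ Or.inr (by positivity)

theorem integrable_mixedSymbol {s t : ℝ} (hs : 0 < s) (ht : 0 < t) :
    Integrable (mixedSymbol (d := d) s t) := by
  refine (integrable_exp_neg_mul_sq_norm (d := d) (τ := 4 * π ^ 2 * t) (by positivity)).mono'
    (continuous_mixedSymbol hs t).aestronglyMeasurable (Eventually.of_forall fun ξ ↦ ?_)
  rw [Real.norm_of_nonneg (mixedSymbol_nonneg s t ξ)]
  exact mixedSymbol_le_gaussian s ht.le ξ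

theorem fourier_ofReal_comp_norm (f : ℝ → ℝ) (x : EuclideanSpace ℝ (Fin d)) :
    𝓕⁻ (fun ξ : EuclideanSpace ℝ (Fin d) ↦ ((f ‖ξ‖ : ℝ) : ℂ)) x =
      𝓕 (fun ξ : EuclideanSpace ℝ (Fin d) ↦ ((f ‖ξ‖ : ℝ) : ℂ)) x := by
  rw [Real.fourierInv_eq_fourier_comp_neg]
  simp only [norm_neg]

theorem integral_fourier_mul_eq {f g : EuclideanSpace ℝ (Fin d) → ℂ} (hf : Integrable f)
    (hg : Integrable g) : ∫ ξ, 𝓕 f ξ * g ξ = ∫ x, f x * 𝓕 g x := by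
  simpa using! VectorFourier.integral_fourierIntegral_smul_eq_flip (L := innerₗ _)
    Real.continuous_fourierChar continuous_inner hf hg

/-! ### The mixed heat kernel is a bounded probability density -/

/-- The mixed heat kernel is the inverse Fourier transform of `mixedSymbol`. -/
theorem ofReal_mixedHeatKernel (hd : 1 ≤ d) {s t : ℝ} (hs : 0 < s) (ht : 0 < t)
    (x : EuclideanSpace ℝ (Fin d)) :
    ((mixedHeatKernel s t x : ℝ) : ℂ) =
      𝓕⁻ (fun ξ : EuclideanSpace ℝ (Fin d) ↦ ((mixedSymbol s t ξ : ℝ) : ℂ)) x := by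
  set b : ℝ := 4 * π ^ 2 * t with hb
  have hb0 : 0 < b := by positivity
  set h : EuclideanSpace ℝ (Fin d) → ℂ := fun ξ ↦
    ((exp (-t * (2 * π * ‖ξ‖) ^ (2 * s)) : ℝ) : ℂ) with hh
  -- `J` is chosen so that its Fourier transform is the Gaussian heat kernel centred at `x`; the
  -- Fourier transform is then moved from `h` to this Gaussian, which returns `J`.
  have hhi : Integrable h := (integrable_exp_neg_mul_norm_rpow hd ht (by positivity)).ofReal
  set J : EuclideanSpace ℝ (Fin d) → ℂ := fun v ↦
    Complex.exp (-(b : ℂ) * ‖v‖ ^ 2 + 2 * π * Complex.I * inner ℝ x v) with hJ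
  have hJi : Integrable J := GaussianFourier.integrable_cexp_neg_mul_sq_norm_add (by simpa) _ _
  have hJc : Continuous J := by fun_prop
  have hFJ : ∀ w, 𝓕 J w = ((1 / (4 * π * t) ^ ((d : ℝ) / 2) *
      exp (-(‖x - w‖ ^ 2 / (4 * t))) : ℝ) : ℂ) := fun w ↦ by
    rw [hJ, fourier_gaussian_innerProductSpace' (by simpa) x w]
    have e1 : ((π : ℂ) / b) = ((1 / (4 * π * t) : ℝ) : ℂ) := by
      rw [← Complex.ofReal_div, hb]
      congr 1
      field_simp
    have e2 : -(π : ℂ) ^ 2 * (‖x - w‖ : ℂ) ^ 2 / b = ((-(‖x - w‖ ^ 2 / (4 * t)) : ℝ) : ℂ) := by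
      rw [hb]
      push_cast
      have : (π : ℂ) ≠ 0 := by exact_mod_cast pi_ne_zero
      have : (t : ℂ) ≠ 0 := by exact_mod_cast ht.ne'
      field_simp
    rw [e1, e2]
    simp only [finrank_euclideanSpace, Fintype.card_fin]
    rw [show ((d : ℂ) / 2) = (((d : ℝ) / 2 : ℝ) : ℂ) by push_cast; rfl,
      ← Complex.ofReal_cpow (by positivity), ← Complex.ofReal_exp, ← Complex.ofReal_mul,
      div_rpow zero_le_one (by positivity), one_rpow]
  have hFJi : Integrable (𝓕 J) := by
    rw [show 𝓕 J = _ from funext hFJ]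
    refine Integrable.ofReal (Integrable.const_mul ?_ _)
    have := (integrable_exp_neg_mul_sq_norm (d := d) (τ := 1 / (4 * t))
      (by positivity)).comp_sub_left x
    refine this.congr (Eventually.of_forall fun w ↦ ?_)
    simp only
    congr 1
    ring
  have hFFJ : ∀ η, 𝓕 (𝓕 J) η = J (-η) := fun η ↦ by
    have := congrFun (hJc.fourierInv_fourier_eq hJi hFJi) (-η)
    rwa [Real.fourierInv_eq_fourier_neg, neg_neg] at this
  have hstep : ((mixedHeatKernel s t x : ℝ) : ℂ) = ∫ ξ, 𝓕 h ξ * 𝓕 J ξ := by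
    unfold mixedHeatKernel
    rw [← integral_const_mul, ← integral_complex_ofReal]
    congr 1 with ξ
    rw [hFJ, ← fourier_ofReal_comp_norm (fun y ↦ exp (-t * (2 * π * y) ^ (2 * s))) ξ,
      ← ofReal_fracHeatKernel]
    push_cast
    ring
  rw [hstep, integral_fourier_mul_eq hhi hFJi, Real.fourierInv_eq', ← integral_neg_eq_self]
  congr 1 with η
  rw [hFFJ, neg_neg, hJ, hh]
  simp only [norm_neg, mixedSymbol, smul_eq_mul]
  rw [real_inner_comm, Complex.exp_add, hb]
  push_cast
  ring_nf

theorem mixedHeatKernel_eq_integral_cos (hd : 1 ≤ d) {s t : ℝ} (hs : 0 < s) (ht : 0 < t)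
    (x : EuclideanSpace ℝ (Fin d)) :
    mixedHeatKernel s t x =
      ∫ ξ : EuclideanSpace ℝ (Fin d), cos (2 * π * inner ℝ ξ x) * mixedSymbol s t ξ := by
  have h := congrArg Complex.re (ofReal_mixedHeatKernel hd hs ht x)
  rw [Complex.ofReal_re, Real.fourierInv_eq'] at h
  have hi : Integrable fun v : EuclideanSpace ℝ (Fin d) ↦
      Complex.exp (↑(2 * π * inner ℝ v x) * Complex.I) • ((mixedSymbol s t v : ℝ) : ℂ) := by
    refine (integrable_mixedSymbol hs ht).mono' ?_ (Eventually.of_forall fun ξ ↦ ?_)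
    · have := continuous_mixedSymbol (d := d) hs t
      exact Continuous.aestronglyMeasurable (by fun_prop)
    · rw [norm_smul, Complex.norm_exp_ofReal_mul_I, one_mul, Complex.norm_real,
        Real.norm_of_nonneg (mixedSymbol_nonneg s t ξ)]
  have h3 := integral_re (𝕜 := ℂ) hi
  simp only [RCLike.re_to_complex] at h3
  rw [h, ← h3]
  congr 1 with ξ
  rw [smul_eq_mul, Complex.re_mul_ofReal, Complex.exp_ofReal_mul_I_re]

theorem mixedHeatKernel_nonneg (hd : 1 ≤ d) {s t : ℝ} (hs0 : 0 < s) (hs1 : s < 1) (ht : 0 < t)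
    (x : EuclideanSpace ℝ (Fin d)) : 0 ≤ mixedHeatKernel s t x := by
  rw [mixedHeatKernel_eq_integral_cos hd hs0 ht]
  convert (IsGaussPos.exp_neg_mul_rpow d hs0 hs1
    (a := t * (2 * π) ^ (2 * s)) (by positivity)).nonneg (4 * π ^ 2 * t) (by positivity) x using 3
    with ξ
  rw [mixedSymbol, mul_assoc, mul_rpow (by positivity) (norm_nonneg _), ← rpow_natCast ‖ξ‖ 2,
    ← rpow_mul (norm_nonneg _)]
  push_cast
  ring_nf

theorem norm_cos_mul_mixedSymbol_le (s t : ℝ) (x ξ : EuclideanSpace ℝ (Fin d)) :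
    ‖cos (2 * π * inner ℝ ξ x) * mixedSymbol s t ξ‖ ≤ mixedSymbol s t ξ := by
  rw [norm_mul, Real.norm_of_nonneg (mixedSymbol_nonneg s t ξ)]
  exact mul_le_of_le_one_left (mixedSymbol_nonneg s t ξ) (abs_cos_le_one _)

theorem mixedHeatKernel_le_integral (hd : 1 ≤ d) {s t : ℝ} (hs : 0 < s) (ht : 0 < t)
    (x : EuclideanSpace ℝ (Fin d)) :
    mixedHeatKernel s t x ≤ ∫ ξ : EuclideanSpace ℝ (Fin d), mixedSymbol s t ξ := by
  rw [mixedHeatKernel_eq_integral_cos hd hs ht]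
  refine (le_abs_self _).trans ?_
  rw [← Real.norm_eq_abs]
  exact norm_integral_le_of_norm_le (integrable_mixedSymbol hs ht)
    (Eventually.of_forall (norm_cos_mul_mixedSymbol_le s t x))

theorem continuous_mixedHeatKernel (hd : 1 ≤ d) {s t : ℝ} (hs : 0 < s) (ht : 0 < t) :
    Continuous (mixedHeatKernel (d := d) s t) := by
  rw [show mixedHeatKernel (d := d) s t = _ from
    funext fun x ↦ mixedHeatKernel_eq_integral_cos hd hs ht x]
  have hc := continuous_mixedSymbol (d := d) hs t
  exact continuous_of_dominated (fun x ↦ Continuous.aestronglyMeasurable (by fun_prop))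
    (fun x ↦ Eventually.of_forall (norm_cos_mul_mixedSymbol_le s t x))
    (integrable_mixedSymbol hs ht) (Eventually.of_forall fun ξ ↦ by fun_prop)

theorem ofReal_mixedHeatKernel_eq_fourier (hd : 1 ≤ d) {s t : ℝ} (hs : 0 < s) (ht : 0 < t)
    (x : EuclideanSpace ℝ (Fin d)) :
    ((mixedHeatKernel s t x : ℝ) : ℂ) =
      𝓕 (fun ξ : EuclideanSpace ℝ (Fin d) ↦ ((mixedSymbol s t ξ : ℝ) : ℂ)) x := by
  rw [ofReal_mixedHeatKernel hd hs ht]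
  exact fourier_ofReal_comp_norm
    (fun y ↦ exp (-(4 * π ^ 2 * t) * y ^ 2) * exp (-t * (2 * π * y) ^ (2 * s))) x

/-- Moving the Fourier transform from the symbol to the damping Gaussian turns the latter into a
probability density, against which the symbol, being at most `1`, integrates to at most `1`. -/
theorem integral_mixedHeatKernel_mul_gaussian_le (hd : 1 ≤ d) {s t : ℝ} (hs : 0 < s) (ht : 0 < t)
    {ε : ℝ} (hε : 0 < ε) :
    ∫ x : EuclideanSpace ℝ (Fin d), mixedHeatKernel s t x * exp (-ε * ‖x‖ ^ 2) ≤ 1 := by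
  set G : EuclideanSpace ℝ (Fin d) → ℂ := fun x ↦ Complex.exp (-(ε : ℂ) * ‖x‖ ^ 2) with hG
  have hGi : Integrable G := by
    simpa [hG] using GaussianFourier.integrable_cexp_neg_mul_sq_norm_add
      (V := EuclideanSpace ℝ (Fin d)) (b := ε) (by simpa) 0 0
  have hFG : ∀ w, 𝓕 G w = (((π / ε) ^ ((d : ℝ) / 2) * exp (-(π ^ 2 / ε) * ‖w‖ ^ 2) : ℝ) : ℂ) :=
    fun w ↦ by
      rw [hG, fourier_gaussian_innerProductSpace (by simpa) w]
      simp only [finrank_euclideanSpace, Fintype.card_fin]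
      rw [show ((d : ℂ) / 2) = (((d : ℝ) / 2 : ℝ) : ℂ) by push_cast; rfl, ← Complex.ofReal_div,
        ← Complex.ofReal_cpow (by positivity)]
      push_cast
      ring_nf
  have h1 : ((∫ x : EuclideanSpace ℝ (Fin d),
      mixedHeatKernel s t x * exp (-ε * ‖x‖ ^ 2) : ℝ) : ℂ) =
      ((∫ x : EuclideanSpace ℝ (Fin d), mixedSymbol s t x *
        ((π / ε) ^ ((d : ℝ) / 2) * exp (-(π ^ 2 / ε) * ‖x‖ ^ 2)) : ℝ) : ℂ) := by
    rw [← integral_complex_ofReal, ← integral_complex_ofReal]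
    have := integral_fourier_mul_eq (integrable_mixedSymbol (d := d) hs ht).ofReal hGi
    simp only [hFG] at this
    refine Eq.trans ?_ (this.trans ?_)
    · congr 1 with x
      rw [Complex.ofReal_mul, ofReal_mixedHeatKernel_eq_fourier hd hs ht x, hG]
      push_cast
      rfl
    · simp only [Complex.ofReal_mul]
      rfl
  rw [Complex.ofReal_inj.1 h1]
  have hgi := (integrable_exp_neg_mul_sq_norm (d := d) (τ := π ^ 2 / ε) (by positivity)).const_mul
    ((π / ε) ^ ((d : ℝ) / 2))
  have hone : ∫ x : EuclideanSpace ℝ (Fin d),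
      (π / ε) ^ ((d : ℝ) / 2) * exp (-(π ^ 2 / ε) * ‖x‖ ^ 2) = 1 := by
    rw [integral_const_mul, GaussianFourier.integral_rexp_neg_mul_sq_norm (by positivity)]
    simp only [finrank_euclideanSpace, Fintype.card_fin]
    rw [← mul_rpow (by positivity) (by positivity),
      show π / ε * (π / (π ^ 2 / ε)) = 1 by field_simp, one_rpow]
  rw [← hone]
  refine integral_mono_of_nonneg (Eventually.of_forall fun x ↦ ?_) hgi
    (Eventually.of_forall fun x ↦ ?_)
  · exact mul_nonneg (mixedSymbol_nonneg s t x) (by positivity)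
  · exact mul_le_of_le_one_left (by positivity) (mixedSymbol_le_one s ht.le x)

/-- By Fatou's lemma, from the uniform bound on the masses of `P_t` damped by wide Gaussians. -/
theorem integrable_mixedHeatKernel (hd : 1 ≤ d) {s t : ℝ} (hs0 : 0 < s) (hs1 : s < 1)
    (ht : 0 < t) : Integrable (mixedHeatKernel (d := d) s t) := by
  have hc := continuous_mixedHeatKernel hd hs0 ht
  have hε : ∀ n : ℕ, (0 : ℝ) < 1 / (n + 1) := fun n ↦ by positivity
  have hn := mixedHeatKernel_nonneg hd hs0 hs1 ht
  have hint : ∀ n : ℕ, Integrable fun x : EuclideanSpace ℝ (Fin d) ↦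
      mixedHeatKernel s t x * exp (-(1 / ((n : ℝ) + 1)) * ‖x‖ ^ 2) := fun n ↦ by
    refine ((integrable_exp_neg_mul_sq_norm (hε n)).const_mul
      (∫ ξ : EuclideanSpace ℝ (Fin d), mixedSymbol s t ξ)).mono'
      (Continuous.aestronglyMeasurable (by fun_prop)) (Eventually.of_forall fun x ↦ ?_)
    rw [Real.norm_of_nonneg (mul_nonneg (hn x) (exp_pos _).le)]
    exact mul_le_mul_of_nonneg_right (mixedHeatKernel_le_integral hd hs0 ht x) (exp_pos _).le
  refine ⟨hc.aestronglyMeasurable, ?_⟩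
  rw [hasFiniteIntegral_iff_ofReal (Eventually.of_forall hn)]
  have hlim : ∀ x : EuclideanSpace ℝ (Fin d), Tendsto (fun n : ℕ ↦ ENNReal.ofReal
      (mixedHeatKernel s t x * exp (-(1 / ((n : ℝ) + 1)) * ‖x‖ ^ 2))) atTop
      (𝓝 (ENNReal.ofReal (mixedHeatKernel s t x))) := fun x ↦ by
    refine ENNReal.tendsto_ofReal ?_
    have h0 : Tendsto (fun n : ℕ ↦ -(1 / ((n : ℝ) + 1)) * ‖x‖ ^ 2) atTop (𝓝 0) := by
      simpa using tendsto_one_div_add_atTop_nhds_zero_nat.neg.mul_const (‖x‖ ^ 2)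
    simpa using ((continuous_exp.tendsto 0).comp h0).const_mul (mixedHeatKernel s t x)
  refine lt_of_le_of_lt ?_ ENNReal.one_lt_top
  calc ∫⁻ x, ENNReal.ofReal (mixedHeatKernel s t x)
      = ∫⁻ x, liminf (fun n : ℕ ↦ ENNReal.ofReal
          (mixedHeatKernel s t x * exp (-(1 / ((n : ℝ) + 1)) * ‖x‖ ^ 2))) atTop := by
        congr 1 with x
        exact (hlim x).liminf_eq.symm
    _ ≤ liminf (fun n : ℕ ↦ ∫⁻ x, ENNReal.ofReal
          (mixedHeatKernel s t x * exp (-(1 / ((n : ℝ) + 1)) * ‖x‖ ^ 2))) atTop :=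
        lintegral_liminf_le fun n ↦ Measurable.ennreal_ofReal (Continuous.measurable (by fun_prop))
    _ ≤ 1 := by
        refine (liminf_le_liminf (Eventually.of_forall fun n ↦ ?_)).trans (liminf_const 1).le
        rw [← ofReal_integral_eq_lintegral_ofReal (hint n)
          (Eventually.of_forall fun x ↦ mul_nonneg (hn x) (exp_pos _).le)]
        exact ENNReal.ofReal_le_one.2 (integral_mixedHeatKernel_mul_gaussian_le hd hs0 ht (hε n))

/-- Fourier inversion at the origin, where the symbol equals `1`. -/
theorem integral_mixedHeatKernel (hd : 1 ≤ d) {s t : ℝ} (hs0 : 0 < s) (hs1 : s < 1)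
    (ht : 0 < t) : ∫ x : EuclideanSpace ℝ (Fin d), mixedHeatKernel s t x = 1 := by
  set g : EuclideanSpace ℝ (Fin d) → ℂ := fun ξ ↦ ((mixedSymbol s t ξ : ℝ) : ℂ) with hg
  have hgi : Integrable g := (integrable_mixedSymbol hs0 ht).ofReal
  have hgc : Continuous g := Complex.continuous_ofReal.comp (continuous_mixedSymbol hs0 t)
  have e : 𝓕 g = fun x ↦ ((mixedHeatKernel s t x : ℝ) : ℂ) :=
    funext fun x ↦ (ofReal_mixedHeatKernel_eq_fourier hd hs0 ht x).symm
  have hFi : Integrable (𝓕 g) := by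
    rw [e]
    exact (integrable_mixedHeatKernel hd hs0 hs1 ht).ofReal
  have h := congrFun (hgc.fourierInv_fourier_eq hgi hFi) 0
  rw [Real.fourierInv_eq', e] at h
  have h' : ((∫ x : EuclideanSpace ℝ (Fin d), mixedHeatKernel s t x : ℝ) : ℂ) = g 0 := by
    rw [← h, ← integral_complex_ofReal]
    simp
  rw [← Complex.ofReal_inj, h', hg]
  simp [mixedSymbol, hs0.ne']

/-- The bound by `t_s ^ (-d/(2s))`, which is `t ^ (-d/2)` when `t ^ s ≥ t` and `t ^ (-d/(2s))`
otherwise. -/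
theorem exists_mixedHeatKernel_le (hd : 1 ≤ d) {s : ℝ} (hs : 0 < s) :
    ∃ A : ℝ, 1 ≤ A ∧ ∀ t : ℝ, 0 < t → ∀ x : EuclideanSpace ℝ (Fin d),
      mixedHeatKernel s t x ≤ A * mixedTime s t ^ (-((d : ℝ) / (2 * s))) := by
  set I : ℝ → ℝ := fun α ↦ ∫ ξ : EuclideanSpace ℝ (Fin d), exp (-(2 * π * ‖ξ‖) ^ α) with hI
  refine ⟨max 1 (max (I 2) (I (2 * s))), le_max_left _ _, fun t ht x ↦ ?_⟩
  refine (mixedHeatKernel_le_integral hd hs ht x).trans ?_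
  have hbd : ∀ α, 0 < α → (∀ ξ : EuclideanSpace ℝ (Fin d),
      mixedSymbol s t ξ ≤ exp (-t * (2 * π * ‖ξ‖) ^ α)) →
      ∫ ξ : EuclideanSpace ℝ (Fin d), mixedSymbol s t ξ ≤ I α * t ^ (-((d : ℝ) / α)) :=
    fun α hα h ↦ by
      rw [mul_comm, hI, ← integral_exp_neg_mul_norm_rpow ht hα]
      exact integral_mono (integrable_mixedSymbol hs ht)
        (integrable_exp_neg_mul_norm_rpow hd ht hα) h
  rcases le_total (t ^ s) t with h | h
  · rw [mixedTime, max_eq_right h]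
    refine (hbd (2 * s) (by positivity) (mixedSymbol_le_exp_rpow s ht.le)).trans ?_
    gcongr
    exact (le_max_right _ _).trans (le_max_right _ _)
  · rw [mixedTime, max_eq_left h, ← rpow_mul ht.le,
      show s * -((d : ℝ) / (2 * s)) = -((d : ℝ) / 2) by field_simp]
    refine (hbd 2 (by positivity) fun ξ ↦ ?_).trans ?_
    · refine (mixedSymbol_le_gaussian s ht.le ξ).trans (le_of_eq ?_)
      rw [rpow_two]
      ring_nf
    · gcongr
      exact (le_max_left _ _).trans (le_max_right _ _)

/-! ### Convolution with a bounded probability density -/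

/-- A continuous probability density `k` on `ℝ^d` that is bounded by `K`. -/
structure IsBoundedDensity (k : EuclideanSpace ℝ (Fin d) → ℝ) (K : ℝ) : Prop where
  continuous : Continuous k
  nonneg : ∀ x, 0 ≤ k x
  integrable : Integrable k
  integral_eq_one : ∫ x, k x = 1
  le_bound : ∀ x, k x ≤ K

namespace IsBoundedDensity
variable {k : EuclideanSpace ℝ (Fin d) → ℝ} {K : ℝ} {φ : EuclideanSpace ℝ (Fin d) → ℝ}

theorem bound_nonneg (hk : IsBoundedDensity k K) : 0 ≤ K := (hk.nonneg 0).trans (hk.le_bound 0)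

theorem integrable_mul (hk : IsBoundedDensity k K) (hφ : Integrable φ)
    (x : EuclideanSpace ℝ (Fin d)) : Integrable fun y ↦ k (x - y) * φ y := by
  have := hk.continuous
  refine (hφ.norm.const_mul K).mono'
    ((Continuous.aestronglyMeasurable (by fun_prop)).mul hφ.aestronglyMeasurable)
    (Eventually.of_forall fun y ↦ ?_)
  rw [norm_mul, Real.norm_of_nonneg (hk.nonneg _)]
  exact mul_le_mul_of_nonneg_right (hk.le_bound _) (norm_nonneg _)

theorem integrable_mul_of_rpow (hk : IsBoundedDensity k K) (hm : AEStronglyMeasurable φ volume)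
    {q : ℝ} (hq : 1 ≤ q) (hφ : Integrable fun y ↦ |φ y| ^ q) (x : EuclideanSpace ℝ (Fin d)) :
    Integrable fun y ↦ k (x - y) * φ y := by
  have := hk.continuous
  refine ((hk.integrable.comp_sub_left x).add (hk.integrable_mul hφ x)).mono'
    ((Continuous.aestronglyMeasurable (by fun_prop)).mul hm) (Eventually.of_forall fun y ↦ ?_)
  have h : |φ y| ≤ 1 + |φ y| ^ q := by
    rcases le_total |φ y| 1 with h | h
    · linarith [rpow_nonneg (abs_nonneg (φ y)) q]
    · linarith [self_le_rpow_of_one_le h hq]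
  rw [norm_mul, Real.norm_of_nonneg (hk.nonneg _), Real.norm_eq_abs]
  calc _ ≤ k (x - y) * (1 + |φ y| ^ q) := mul_le_mul_of_nonneg_left h (hk.nonneg _)
    _ = _ := by simp [mul_add]

theorem lintegral_ofReal_left (hk : IsBoundedDensity k K) (x : EuclideanSpace ℝ (Fin d)) :
    ∫⁻ y, ENNReal.ofReal (k (x - y)) = 1 := by
  rw [← ofReal_integral_eq_lintegral_ofReal (hk.integrable.comp_sub_left x)
    (Eventually.of_forall fun y ↦ hk.nonneg _), integral_sub_left_eq_self k volume x,
    hk.integral_eq_one, ENNReal.ofReal_one]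

theorem lintegral_ofReal_right (hk : IsBoundedDensity k K) (y : EuclideanSpace ℝ (Fin d)) :
    ∫⁻ x, ENNReal.ofReal (k (x - y)) = 1 := by
  rw [← ofReal_integral_eq_lintegral_ofReal (hk.integrable.comp_sub_right y)
    (Eventually.of_forall fun y ↦ hk.nonneg _), integral_sub_right_eq_self k y,
    hk.integral_eq_one, ENNReal.ofReal_one]

/-- Jensen's inequality for the probability measure with density `y ↦ k (x - y)`. -/
theorem map_integral_le (hk : IsBoundedDensity k K) {Φ : ℝ → ℝ} (hΦ : ConvexOn ℝ univ Φ)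
    (hΦc : Continuous Φ) {x : EuclideanSpace ℝ (Fin d)}
    (hφ : Integrable fun y ↦ k (x - y) * φ y) (hΦφ : Integrable fun y ↦ Φ (φ y)) :
    Φ (∫ y, k (x - y) * φ y) ≤ ∫ y, k (x - y) * Φ (φ y) := by
  have hc := hk.continuous
  have hmeas : Measurable fun y : EuclideanSpace ℝ (Fin d) ↦ ENNReal.ofReal (k (x - y)) :=
    Measurable.ennreal_ofReal (Continuous.measurable (by fun_prop))
  have htop : ∀ᵐ y : EuclideanSpace ℝ (Fin d), ENNReal.ofReal (k (x - y)) < ∞ :=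
    Eventually.of_forall fun y ↦ ENNReal.ofReal_lt_top
  set μ := (volume : Measure (EuclideanSpace ℝ (Fin d))).withDensity
    fun y ↦ ENNReal.ofReal (k (x - y)) with hμ
  have : IsProbabilityMeasure μ := ⟨by
    rw [hμ, withDensity_apply _ MeasurableSet.univ, Measure.restrict_univ,
      hk.lintegral_ofReal_left]⟩
  have hint : ∀ ψ : EuclideanSpace ℝ (Fin d) → ℝ, ∫ y, ψ y ∂μ = ∫ y, k (x - y) * ψ y := fun ψ ↦ by
    rw [hμ, integral_withDensity_eq_integral_toReal_smul hmeas htop]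
    simp only [ENNReal.toReal_ofReal (hk.nonneg _), smul_eq_mul]
  have hintble : ∀ ψ : EuclideanSpace ℝ (Fin d) → ℝ,
      (Integrable fun y ↦ k (x - y) * ψ y) → Integrable ψ μ := fun ψ h ↦ by
    rw [hμ, integrable_withDensity_iff_integrable_smul' hmeas htop]
    simpa only [ENNReal.toReal_ofReal (hk.nonneg _), smul_eq_mul] using h
  have := hΦ.map_integral_le (μ := μ) hΦc.continuousOn isClosed_univ
    (Eventually.of_forall fun _ ↦ mem_univ _) (hintble φ hφ)
    (hintble (Φ ∘ φ) (hk.integrable_mul hΦφ x))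
  rwa [hint, hint] at this

theorem map_integral_le_mul (hk : IsBoundedDensity k K) {Φ : ℝ → ℝ} (hΦ : ConvexOn ℝ univ Φ)
    (hΦc : Continuous Φ) (hΦ0 : ∀ z, 0 ≤ Φ z) {x : EuclideanSpace ℝ (Fin d)}
    (hφ : Integrable fun y ↦ k (x - y) * φ y) (hΦφ : Integrable fun y ↦ Φ (φ y)) :
    Φ (∫ y, k (x - y) * φ y) ≤ K * ∫ y, Φ (φ y) := by
  refine (hk.map_integral_le hΦ hΦc hφ hΦφ).trans ?_
  rw [← integral_const_mul]
  exact integral_mono (hk.integrable_mul hΦφ x) (hΦφ.const_mul K) fun y ↦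
    mul_le_mul_of_nonneg_right (hk.le_bound _) (hΦ0 _)

/-- Convolution with a probability density does not increase convex modulars: Jensen's inequality
followed by Tonelli's theorem. -/
theorem lintegral_map_integral_le (hk : IsBoundedDensity k K) {Φ : ℝ → ℝ}
    (hΦ : ConvexOn ℝ univ Φ) (hΦc : Continuous Φ) (hΦ0 : ∀ z, 0 ≤ Φ z)
    (hφ : ∀ x, Integrable fun y ↦ k (x - y) * φ y) (hΦφ : Integrable fun y ↦ Φ (φ y)) :
    ∫⁻ x, ENNReal.ofReal (Φ (∫ y, k (x - y) * φ y)) ≤ ∫⁻ y, ENNReal.ofReal (Φ (φ y)) := by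
  have hc := hk.continuous
  calc ∫⁻ x, ENNReal.ofReal (Φ (∫ y, k (x - y) * φ y))
      ≤ ∫⁻ x, ∫⁻ y, ENNReal.ofReal (k (x - y)) * ENNReal.ofReal (Φ (φ y)) := by
        refine lintegral_mono fun x ↦ ?_
        refine (ENNReal.ofReal_le_ofReal (hk.map_integral_le hΦ hΦc (hφ x) hΦφ)).trans ?_
        rw [ofReal_integral_eq_lintegral_ofReal (hk.integrable_mul hΦφ x)
          (Eventually.of_forall fun y ↦ mul_nonneg (hk.nonneg _) (hΦ0 _))]
        simp only [ENNReal.ofReal_mul (hk.nonneg _), le_refl]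
    _ = ∫⁻ y, ∫⁻ x, ENNReal.ofReal (k (x - y)) * ENNReal.ofReal (Φ (φ y)) := by
        refine lintegral_lintegral_swap ?_
        refine AEMeasurable.mul
          (f := fun z : EuclideanSpace ℝ (Fin d) × EuclideanSpace ℝ (Fin d) ↦
            ENNReal.ofReal (k (z.1 - z.2))) (g := fun z ↦ ENNReal.ofReal (Φ (φ z.2))) ?_ ?_
        · exact (Measurable.ennreal_ofReal (Continuous.measurable (by fun_prop))).aemeasurable
        · exact hΦφ.aestronglyMeasurable.comp_snd.aemeasurable.ennreal_ofReal
    _ = ∫⁻ y, ENNReal.ofReal (Φ (φ y)) := by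
        congr 1 with y
        rw [lintegral_mul_const _ (Measurable.ennreal_ofReal (Continuous.measurable (by fun_prop))),
          hk.lintegral_ofReal_right, one_mul]

theorem aestronglyMeasurable_integral (hk : IsBoundedDensity k K)
    (hm : AEStronglyMeasurable φ volume) :
    AEStronglyMeasurable (fun x ↦ ∫ y, k (x - y) * φ y) volume := by
  have hc := hk.continuous
  refine AEStronglyMeasurable.integral_prod_right' (f := fun z :
    EuclideanSpace ℝ (Fin d) × EuclideanSpace ℝ (Fin d) ↦ k (z.1 - z.2) * φ z.2) ?_
  exact (Continuous.aestronglyMeasurable (by fun_prop)).mul hm.comp_snd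

end IsBoundedDensity

/-! ### The exponential modular -/

theorem convexOn_abs_rpow {p : ℝ} (hp : 1 ≤ p) : ConvexOn ℝ univ fun z : ℝ ↦ |z| ^ p := by
  refine ⟨convex_univ, fun x _ y _ a b ha hb hab ↦ ?_⟩
  refine le_trans ?_ ((convexOn_rpow hp).2 (abs_nonneg x) (abs_nonneg y) ha hb hab)
  refine rpow_le_rpow (abs_nonneg _) ?_ (by linarith)
  simpa [abs_mul, abs_of_nonneg ha, abs_of_nonneg hb] using abs_add_le (a * x) (b * y)

theorem continuous_abs_rpow {p : ℝ} (hp : 0 ≤ p) : Continuous fun z : ℝ ↦ |z| ^ p :=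
  continuous_abs.rpow_const fun _ ↦ Or.inr hp

theorem convexOn_exp_abs_rpow {p c : ℝ} (hp : 1 ≤ p) (hc : 0 < c) :
    ConvexOn ℝ univ fun z : ℝ ↦ exp (|z| ^ p / c ^ p) - 1 := by
  have h : ConvexOn ℝ univ fun z : ℝ ↦ exp (|z| ^ p / c ^ p) := by
    refine ⟨convex_univ, fun x _ y _ a b ha hb hab ↦ ?_⟩
    refine le_trans ?_ (convexOn_exp.2 (mem_univ (|x| ^ p / c ^ p)) (mem_univ (|y| ^ p / c ^ p))
      ha hb hab)
    refine exp_le_exp.2 ?_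
    have := (convexOn_abs_rpow hp).2 (mem_univ x) (mem_univ y) ha hb hab
    simp only [smul_eq_mul] at this ⊢
    rw [← mul_div_assoc, ← mul_div_assoc, ← add_div]
    gcongr
  simp only [sub_eq_add_neg]
  exact h.add_const (-1)

theorem continuous_exp_abs_rpow {p c : ℝ} (hp : 0 ≤ p) :
    Continuous fun z : ℝ ↦ exp (|z| ^ p / c ^ p) - 1 :=
  (continuous_exp.comp ((continuous_abs_rpow hp).div_const _)).sub continuous_const

theorem exp_abs_rpow_sub_one_nonneg {p c : ℝ} (hc : 0 < c) (z : ℝ) :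
    0 ≤ exp (|z| ^ p / c ^ p) - 1 := by
  rw [sub_nonneg, one_le_exp_iff]
  positivity

theorem integrable_exp_abs_rpow_of_expModular_lt_top {p c : ℝ} (hp : 0 ≤ p) (hc : 0 < c)
    {φ : EuclideanSpace ℝ (Fin d) → ℝ} (hm : AEStronglyMeasurable φ volume)
    (h : expModular p φ c < ∞) : Integrable fun y ↦ exp (|φ y| ^ p / c ^ p) - 1 :=
  ⟨(continuous_exp_abs_rpow hp).comp_aestronglyMeasurable hm,
    (hasFiniteIntegral_iff_ofReal
      (Eventually.of_forall fun _ ↦ exp_abs_rpow_sub_one_nonneg hc _)).2 h⟩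

theorem integrable_abs_rpow_of_expModular_lt_top {p c : ℝ} (hp : 0 ≤ p) (hc : 0 < c)
    {φ : EuclideanSpace ℝ (Fin d) → ℝ} (hm : AEStronglyMeasurable φ volume)
    (h : expModular p φ c < ∞) : Integrable fun y ↦ |φ y| ^ p := by
  refine ((integrable_exp_abs_rpow_of_expModular_lt_top hp hc hm h).const_mul (c ^ p)).mono'
    ((continuous_abs_rpow hp).comp_aestronglyMeasurable hm) (Eventually.of_forall fun y ↦ ?_)
  rw [Real.norm_of_nonneg (by positivity), ← div_le_iff₀' (by positivity)]
  linarith [add_one_le_exp (|φ y| ^ p / c ^ p)]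

/-- With `w = |z| / M ∈ [0, 1]` and `Y = (M / c) ^ p`, convexity of `exp` between `0` and `Y` bounds
`exp (w ^ p * Y) - 1` by `w ^ p * (exp Y - 1)`, and `w ^ p ≤ w ^ q`. -/
theorem exp_abs_rpow_sub_one_le {p q M c z : ℝ} (hq : 0 < q) (hqp : q ≤ p) (hM : 0 < M)
    (hc : 0 < c) (hz : |z| ≤ M) :
    exp (|z| ^ p / c ^ p) - 1 ≤ (exp ((M / c) ^ p) - 1) / M ^ q * |z| ^ q := by
  have hw0 : 0 ≤ |z| / M := by positivity
  have hw1 : |z| / M ≤ 1 := (div_le_one hM).2 hz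
  have hwp1 : (|z| / M) ^ p ≤ 1 := rpow_le_one hw0 hw1 (by linarith)
  have hwp0 : 0 ≤ (|z| / M) ^ p := by positivity
  have hle : (|z| / M) ^ p ≤ (|z| / M) ^ q := by
    rcases hw0.eq_or_lt with h | h
    · rw [← h, zero_rpow (by linarith), zero_rpow hq.ne']
    · exact rpow_le_rpow_of_exponent_ge h hw1 hqp
  have e : |z| ^ p / c ^ p = (|z| / M) ^ p * (M / c) ^ p := by
    rw [← mul_rpow hw0 (by positivity), ← div_rpow (abs_nonneg z) hc.le]
    congr 1
    field_simp
  have hconv := convexOn_exp.2 (mem_univ ((M / c) ^ p)) (mem_univ 0) hwp0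
    (sub_nonneg.2 hwp1) (by ring)
  simp only [smul_eq_mul, mul_zero, add_zero, exp_zero, mul_one] at hconv
  have h1 : 0 ≤ exp ((M / c) ^ p) - 1 := by
    rw [sub_nonneg, one_le_exp_iff]
    positivity
  calc exp (|z| ^ p / c ^ p) - 1 ≤ (|z| / M) ^ p * (exp ((M / c) ^ p) - 1) := by
        rw [e]
        linarith
    _ ≤ (|z| / M) ^ q * (exp ((M / c) ^ p) - 1) := mul_le_mul_of_nonneg_right hle h1
    _ = _ := by
        rw [div_rpow (abs_nonneg z) hM.le]
        ring

theorem locallyIntegrable_of_abs_le {u : EuclideanSpace ℝ (Fin d) → ℝ}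
    (hm : AEStronglyMeasurable u volume) {M : ℝ} (hM : ∀ x, |u x| ≤ M) :
    LocallyIntegrable u volume :=
  (memLp_top_of_bound hm M (Eventually.of_forall hM)).locallyIntegrable le_top

theorem expLpNorm_le_of_expModular_le {p c : ℝ} {u : EuclideanSpace ℝ (Fin d) → ℝ} (hc : 0 < c)
    (h : expModular p u c ≤ 1) : expLpNorm p u ≤ ENNReal.ofReal c :=
  sInf_le ⟨c, ⟨hc, h⟩, rfl⟩

/-- A sup bound `M` and an `L^q` bound `N` control the modular at the scale `c = M * L ^ (-1/p)`,
for which `(M / c) ^ p = L`. -/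
theorem expModular_le_one_of_abs_le {p q M N L : ℝ} {u : EuclideanSpace ℝ (Fin d) → ℝ}
    (hq : 1 ≤ q) (hqp : q ≤ p) (hN : 0 ≤ N) (hM : 0 < M) (hL : 0 < L)
    (hu : ∀ x, |u x| ≤ M) (hint : ∫⁻ x, ENNReal.ofReal (|u x| ^ q) ≤ ENNReal.ofReal (N ^ q))
    (hle : (exp L - 1) * (N / M) ^ q ≤ 1) : expModular p u (M * L ^ (-(1 / p))) ≤ 1 := by
  have hp0 : 0 < p := by linarith
  have hc : 0 < M * L ^ (-(1 / p)) := by positivity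
  have e : (M / (M * L ^ (-(1 / p)))) ^ p = L := by
    rw [div_mul_cancel_left₀ hM.ne', rpow_neg hL.le, inv_inv, ← rpow_mul hL.le,
      one_div_mul_cancel hp0.ne', rpow_one]
  have h0 : 0 ≤ (exp L - 1) / M ^ q := by
    have : 0 ≤ exp L - 1 := by linarith [add_one_le_exp L]
    positivity
  calc expModular p u (M * L ^ (-(1 / p)))
      ≤ ∫⁻ x, ENNReal.ofReal ((exp L - 1) / M ^ q) * ENNReal.ofReal (|u x| ^ q) := by
        refine lintegral_mono fun x ↦ ?_
        rw [← ENNReal.ofReal_mul h0]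
        refine ENNReal.ofReal_le_ofReal ?_
        have := exp_abs_rpow_sub_one_le (by linarith : 0 < q) hqp hM hc (hu x)
        rwa [e] at this
    _ = ENNReal.ofReal ((exp L - 1) / M ^ q) * ∫⁻ x, ENNReal.ofReal (|u x| ^ q) :=
        lintegral_const_mul' _ _ ENNReal.ofReal_ne_top
    _ ≤ ENNReal.ofReal ((exp L - 1) / M ^ q) * ENNReal.ofReal (N ^ q) := by gcongr
    _ ≤ 1 := by
        rw [← ENNReal.ofReal_mul h0, ENNReal.ofReal_le_one]
        refine le_of_eq_of_le ?_ hle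
        rw [div_rpow hN hM.le]
        ring

theorem expModular_zero {p : ℝ} (hp : 0 < p) (c : ℝ) :
    expModular p (fun _ : EuclideanSpace ℝ (Fin d) ↦ (0 : ℝ)) c = 0 := by
  simp [expModular, hp.ne']

theorem expLpNorm_zero {p : ℝ} (hp : 0 < p) :
    expLpNorm p (fun _ : EuclideanSpace ℝ (Fin d) ↦ (0 : ℝ)) = 0 := by
  refine le_antisymm (ENNReal.le_of_forall_pos_le_add fun ε hε _ ↦ ?_) zero_le
  rw [zero_add]
  refine (expLpNorm_le_of_expModular_le (c := ε) hε ?_).trans (by simp)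
  simp [expModular_zero hp]

theorem memExpLp_zero {p : ℝ} (hp : 0 < p) :
    MemExpLp p (fun _ : EuclideanSpace ℝ (Fin d) ↦ (0 : ℝ)) :=
  ⟨locallyIntegrable_zero, 1, one_pos, by simp [expModular_zero hp]⟩

theorem MeasureTheory.MemLp.integrable_abs_rpow {φ : EuclideanSpace ℝ (Fin d) → ℝ} {q : ℝ}
    (hq : 0 < q) (hφ : MemLp φ (ENNReal.ofReal q) volume) : Integrable fun y ↦ |φ y| ^ q := by
  have := hφ.integrable_norm_rpow (by simpa using hq) ENNReal.ofReal_ne_top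
  simpa [ENNReal.toReal_ofReal hq.le] using this

theorem MeasureTheory.MemLp.integral_abs_rpow {φ : EuclideanSpace ℝ (Fin d) → ℝ} {q : ℝ}
    (hq : 0 < q) (hφ : MemLp φ (ENNReal.ofReal q) volume) :
    ∫ y, |φ y| ^ q = (eLpNorm φ (ENNReal.ofReal q) volume).toReal ^ q := by
  have h0 : 0 ≤ ∫ y, |φ y| ^ q := integral_nonneg fun y ↦ by positivity
  rw [hφ.eLpNorm_eq_integral_rpow_norm (by simpa using hq) ENNReal.ofReal_ne_top]
  simp only [Real.norm_eq_abs, ENNReal.toReal_ofReal hq.le]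
  rw [ENNReal.toReal_ofReal (by positivity), rpow_inv_rpow h0 hq.ne']

/-! ### Lebesgue-norm estimates for the convolution -/

namespace IsBoundedDensity
variable {k : EuclideanSpace ℝ (Fin d) → ℝ} {K : ℝ} {φ : EuclideanSpace ℝ (Fin d) → ℝ}

theorem lintegral_abs_rpow_le (hk : IsBoundedDensity k K) {q : ℝ} (hq : 1 ≤ q)
    (hφ : MemLp φ (ENNReal.ofReal q) volume) :
    ∫⁻ x, ENNReal.ofReal (|∫ y, k (x - y) * φ y| ^ q) ≤
      ENNReal.ofReal ((eLpNorm φ (ENNReal.ofReal q) volume).toReal ^ q) := by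
  have hq0 : 0 < q := by linarith
  have hi := hφ.integrable_abs_rpow hq0
  refine (hk.lintegral_map_integral_le (convexOn_abs_rpow hq) (continuous_abs_rpow hq0.le)
    (fun z ↦ by positivity) (hk.integrable_mul_of_rpow hφ.aestronglyMeasurable hq hi) hi).trans ?_
  rw [← ofReal_integral_eq_lintegral_ofReal hi (Eventually.of_forall fun y ↦ by positivity),
    hφ.integral_abs_rpow hq0]

/-- The bound from `L^r` to `L^∞`; for `r = ∞` the exponent `r⁻¹` is `0` and the power of `K` is
`1`. -/
theorem abs_integral_le (hk : IsBoundedDensity k K) {r : ℝ≥0∞} (hr : 1 ≤ r)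
    (hφ : MemLp φ r volume) {x : EuclideanSpace ℝ (Fin d)}
    (hφi : Integrable fun y ↦ k (x - y) * φ y) :
    |∫ y, k (x - y) * φ y| ≤ K ^ (r⁻¹).toReal * (eLpNorm φ r volume).toReal := by
  rcases eq_or_ne r ∞ with rfl | htop
  · simp only [ENNReal.inv_top, ENNReal.toReal_zero, rpow_zero, one_mul]
    have hae : ∀ᵐ y, ‖φ y‖ ≤ (eLpNorm φ ∞ volume).toReal := by
      filter_upwards [ae_le_eLpNormEssSup (f := φ) (μ := volume)] with y hy
      rw [← eLpNorm_exponent_top] at hy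
      have := ENNReal.toReal_mono hφ.eLpNorm_ne_top hy
      simpa using this
    rw [← Real.norm_eq_abs]
    refine (norm_integral_le_of_norm_le ((hk.integrable.comp_sub_left x).mul_const
      (eLpNorm φ ∞ volume).toReal) ?_).trans (le_of_eq ?_)
    · filter_upwards [hae] with y hy
      rw [norm_mul, Real.norm_of_nonneg (hk.nonneg _)]
      exact mul_le_mul_of_nonneg_left hy (hk.nonneg _)
    · rw [integral_mul_const, integral_sub_left_eq_self k volume x, hk.integral_eq_one, one_mul]
  · obtain ⟨ρ, hρ, rfl⟩ : ∃ ρ : ℝ, 1 ≤ ρ ∧ ENNReal.ofReal ρ = r :=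
      ⟨r.toReal, by simpa using ENNReal.toReal_mono htop hr, ENNReal.ofReal_toReal htop⟩
    have hρ0 : 0 < ρ := by linarith
    have h := hk.map_integral_le_mul (convexOn_abs_rpow hρ) (continuous_abs_rpow hρ0.le)
      (fun z ↦ by positivity) hφi (hφ.integrable_abs_rpow hρ0)
    rw [hφ.integral_abs_rpow hρ0] at h
    rw [ENNReal.toReal_inv, ENNReal.toReal_ofReal hρ0.le]
    have hK := hk.bound_nonneg
    rw [← rpow_le_rpow_iff (abs_nonneg _) (by positivity) hρ0,
      mul_rpow (by positivity) (by positivity), rpow_inv_rpow hK hρ0.ne']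
    exact h

end IsBoundedDensity

/-! ### The semigroup on exponential Orlicz spaces -/

theorem isBoundedDensity_mixedHeatKernel (hd : 1 ≤ d) {s t K : ℝ} (hs0 : 0 < s) (hs1 : s < 1)
    (ht : 0 < t) (hK : ∀ x : EuclideanSpace ℝ (Fin d), mixedHeatKernel s t x ≤ K) :
    IsBoundedDensity (mixedHeatKernel (d := d) s t) K where
  continuous := continuous_mixedHeatKernel hd hs0 ht
  nonneg := mixedHeatKernel_nonneg hd hs0 hs1 ht
  integrable := integrable_mixedHeatKernel hd hs0 hs1 ht
  integral_eq_one := integral_mixedHeatKernel hd hs0 hs1 ht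
  le_bound := hK

theorem mixedHeat_eq_zero {s t : ℝ} {φ : EuclideanSpace ℝ (Fin d) → ℝ} (hφ : φ =ᵐ[volume] 0) :
    mixedHeat s t φ = fun _ ↦ 0 := by
  ext x
  refine integral_eq_zero_of_ae ?_
  filter_upwards [hφ] with y hy
  simp [hy]

/-- The semigroup contracts the Luxemburg norm, since it does not increase the modular at any
scale where the latter is finite. -/
theorem mixedHeat_contraction {s t p K : ℝ} (hp : 1 ≤ p)
    (hk : IsBoundedDensity (mixedHeatKernel (d := d) s t) K)
    {φ : EuclideanSpace ℝ (Fin d) → ℝ} (hφ : MemExpLp p φ) :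
    MixedHeatConverges s t φ ∧ MemExpLp p (mixedHeat s t φ) ∧
      expLpNorm p (mixedHeat s t φ) ≤ expLpNorm p φ := by
  obtain ⟨hloc, c, hc, hfin⟩ := hφ
  have hp0 : 0 < p := by linarith
  have hm := hloc.aestronglyMeasurable
  have hi := integrable_abs_rpow_of_expModular_lt_top hp0.le hc hm hfin
  have hconv : MixedHeatConverges s t φ := hk.integrable_mul_of_rpow hm hp hi
  have hmod : ∀ c, 0 < c → expModular p φ c < ∞ →
      expModular p (mixedHeat s t φ) c ≤ expModular p φ c := fun c hc hfin ↦
    hk.lintegral_map_integral_le (convexOn_exp_abs_rpow hp hc) (continuous_exp_abs_rpow hp0.le)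
      (exp_abs_rpow_sub_one_nonneg hc) hconv
      (integrable_exp_abs_rpow_of_expModular_lt_top hp0.le hc hm hfin)
  have hbd : ∀ x, |mixedHeat s t φ x| ≤ (K * ∫ y, |φ y| ^ p) ^ (1 / p) := fun x ↦ by
    have h := hk.map_integral_le_mul (convexOn_abs_rpow hp) (continuous_abs_rpow hp0.le)
      (fun z ↦ by positivity) (hconv x) hi
    rw [← rpow_le_rpow_iff (abs_nonneg _) (by have := h.trans' (by positivity); positivity) hp0,
      ← rpow_mul (h.trans' (by positivity)), one_div_mul_cancel hp0.ne', rpow_one]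
    exact h
  refine ⟨hconv, ⟨locallyIntegrable_of_abs_le (hk.aestronglyMeasurable_integral hm) hbd, c, hc,
    (hmod c hc hfin).trans_lt hfin⟩, sInf_le_sInf (image_mono ?_)⟩
  exact fun c ⟨hc, h⟩ ↦ ⟨hc, (hmod c hc (h.trans_lt ENNReal.one_lt_top)).trans h⟩

/-- The common part of the two smoothing estimates; they differ in the sup bound `M` and in the
value `L` prescribed for `(M / c) ^ p` at the scale `c` of the modular. -/
theorem mixedHeat_memExpLp_of_abs_le {s t p q K : ℝ} (hq : 1 ≤ q) (hqp : q ≤ p)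
    (hk : IsBoundedDensity (mixedHeatKernel (d := d) s t) K)
    {φ : EuclideanSpace ℝ (Fin d) → ℝ} (hφ : MemLp φ (ENNReal.ofReal q) volume) {M L B : ℝ}
    (hM : 0 < M) (hL : 0 < L) (hu : ∀ x, |mixedHeat s t φ x| ≤ M)
    (hle : (exp L - 1) * ((eLpNorm φ (ENNReal.ofReal q) volume).toReal / M) ^ q ≤ 1)
    (hB : M * L ^ (-(1 / p)) ≤ B) :
    MemExpLp p (mixedHeat s t φ) ∧ expLpNorm p (mixedHeat s t φ) ≤ ENNReal.ofReal B := by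
  have hmod := expModular_le_one_of_abs_le hq hqp ENNReal.toReal_nonneg hM hL hu
    (hk.lintegral_abs_rpow_le hq hφ) hle
  exact ⟨⟨locallyIntegrable_of_abs_le (hk.aestronglyMeasurable_integral hφ.aestronglyMeasurable) hu,
    _, by positivity, hmod.trans_lt ENNReal.one_lt_top⟩,
    (expLpNorm_le_of_expModular_le (by positivity) hmod).trans (ENNReal.ofReal_le_ofReal hB)⟩

theorem rpow_mul_le_mul_rpow {A τ e : ℝ} (hA : 1 ≤ A) (hτ : 0 ≤ τ) (he : e ≤ 1) :
    (A * τ) ^ e ≤ A * τ ^ e := by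
  rw [mul_rpow (by linarith) hτ]
  gcongr
  simpa using rpow_le_rpow_of_exponent_le hA he

end

theorem proposition3p1 (d : ℕ) (hd : 1 ≤ d) (s : ℝ) (hs0 : 0 < s) (hs1 : s < 1) :
    (∀ p : ℝ, 1 ≤ p → ∀ t : ℝ, 0 < t → ∀ φ : EuclideanSpace ℝ (Fin d) → ℝ, MemExpLp p φ →
      MixedHeatConverges s t φ ∧ MemExpLp p (mixedHeat s t φ) ∧
        expLpNorm p (mixedHeat s t φ) ≤ expLpNorm p φ) ∧
    (∃ C : ℝ, 0 < C ∧ ∀ p q : ℝ, 1 ≤ q → q ≤ p → ∀ t : ℝ, 0 < t →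
      ∀ φ : EuclideanSpace ℝ (Fin d) → ℝ, MemLp φ (ENNReal.ofReal q) volume →
        MixedHeatConverges s t φ ∧ MemExpLp p (mixedHeat s t φ) ∧
          expLpNorm p (mixedHeat s t φ) ≤
            ENNReal.ofReal (C * (mixedTime s t ^ (-((d : ℝ) / (2 * s * q))) *
              log (mixedTime s t ^ (-((d : ℝ) / (2 * s))) + 1) ^ (-(1 / p)))) *
              eLpNorm φ (ENNReal.ofReal q) volume) ∧
    (∃ C : ℝ, 0 < C ∧ ∀ p q : ℝ, 1 ≤ q → q ≤ p → ∀ r : ℝ≥0∞, 1 ≤ r → ∀ t : ℝ, 0 < t →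
      ∀ φ : EuclideanSpace ℝ (Fin d) → ℝ, MemLp φ r volume →
        MemLp φ (ENNReal.ofReal q) volume →
        MixedHeatConverges s t φ ∧ MemExpLp p (mixedHeat s t φ) ∧
          expLpNorm p (mixedHeat s t φ) ≤
            ENNReal.ofReal (C * (1 / log 2 ^ (1 / p))) *
              (ENNReal.ofReal (mixedTime s t ^ (-((d : ℝ) / (2 * s) * (r⁻¹).toReal))) *
                eLpNorm φ r volume + eLpNorm φ (ENNReal.ofReal q) volume)) := by
  obtain ⟨A, hA1, hA⟩ := exists_mixedHeatKernel_le hd hs0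
  have hA0 : 0 < A := by linarith
  have hk : ∀ t, 0 < t → IsBoundedDensity (mixedHeatKernel (d := d) s t)
      (A * mixedTime s t ^ (-((d : ℝ) / (2 * s)))) := fun t ht ↦
    isBoundedDensity_mixedHeatKernel hd hs0 hs1 ht (hA t ht)
  have htime : ∀ t, 0 < t → 0 < mixedTime s t := fun t ht ↦ lt_max_of_lt_right ht
  have hconv : ∀ q, 1 ≤ q → ∀ t, 0 < t → ∀ φ : EuclideanSpace ℝ (Fin d) → ℝ,
      MemLp φ (ENNReal.ofReal q) volume → MixedHeatConverges s t φ := fun q hq t ht φ hφ ↦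
    (hk t ht).integrable_mul_of_rpow hφ.aestronglyMeasurable hq
      (hφ.integrable_abs_rpow (by linarith))
  have hzero : ∀ p q : ℝ, 1 ≤ q → q ≤ p → ∀ t, ∀ φ : EuclideanSpace ℝ (Fin d) → ℝ,
      MemLp φ (ENNReal.ofReal q) volume → (eLpNorm φ (ENNReal.ofReal q) volume).toReal = 0 →
      MemExpLp p (mixedHeat s t φ) ∧ expLpNorm p (mixedHeat s t φ) = 0 :=
      fun p q hq hqp t φ hφ h ↦ by
    have hp0 : 0 < p := by linarith
    have h0 : φ =ᵐ[volume] 0 := (eLpNorm_eq_zero_iff hφ.aestronglyMeasurable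
      (by simpa using (by linarith : 0 < q))).1
      ((ENNReal.toReal_eq_zero_iff _).1 h |>.resolve_right hφ.eLpNorm_ne_top)
    rw [mixedHeat_eq_zero h0]
    exact ⟨memExpLp_zero hp0, expLpNorm_zero hp0⟩
  refine ⟨fun p hp t ht φ hφ ↦ mixedHeat_contraction hp (hk t ht) hφ,
    ⟨A, hA0, fun p q hq hqp t ht φ hφ ↦ ⟨hconv q hq t ht φ hφ, ?_⟩⟩,
    ⟨A, hA0, fun p q hq hqp r hr t ht φ hφr hφ ↦ ⟨hconv q hq t ht φ hφ, ?_⟩⟩⟩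
  · have hq0 : 0 < q := by linarith
    set N := (eLpNorm φ (ENNReal.ofReal q) volume).toReal with hN
    have hNe : eLpNorm φ (ENNReal.ofReal q) volume = ENNReal.ofReal N :=
      (ENNReal.ofReal_toReal hφ.eLpNorm_ne_top).symm
    -- For `φ = 0` the scale `c` below would degenerate to `0`.
    rcases (ENNReal.toReal_nonneg : 0 ≤ N).eq_or_lt with h0 | hN0
    · obtain ⟨h1, h2⟩ := hzero p q hq hqp t φ hφ h0.symm
      exact ⟨h1, h2.le.trans zero_le⟩
    -- With `M = (A τ) ^ (1 / q) * N` the factor `(N / M) ^ q` is `1 / (A τ)`, and `L = log (τ + 1)`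
    -- makes `exp L - 1 = τ`.
    set τ := mixedTime s t ^ (-((d : ℝ) / (2 * s))) with hτ
    have hτ0 : 0 < τ := rpow_pos_of_pos (htime t ht) _
    have hτq : mixedTime s t ^ (-((d : ℝ) / (2 * s * q))) = τ ^ q⁻¹ := by
      rw [hτ, ← rpow_mul (htime t ht).le]
      congr 1
      field_simp
    have hL : 0 < log (τ + 1) := log_pos (by linarith)
    rw [hNe, hτq, ← ENNReal.ofReal_mul (by positivity)]
    refine mixedHeat_memExpLp_of_abs_le hq hqp (hk t ht) hφ (M := (A * τ) ^ q⁻¹ * N)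
      (L := log (τ + 1)) (by positivity) hL (fun x ↦ ?_) ?_ ?_
    · have := (hk t ht).abs_integral_le (by simpa using hq) hφ (hconv q hq t ht φ hφ x)
      rwa [ENNReal.toReal_inv, ENNReal.toReal_ofReal hq0.le] at this
    · rw [exp_log (by linarith), add_sub_cancel_right, ← hN, div_mul_cancel_right₀ hN0.ne',
        inv_rpow (by positivity), rpow_inv_rpow (by positivity) hq0.ne', ← div_eq_mul_inv,
        div_le_one (by positivity)]
      exact le_mul_of_one_le_left hτ0.le hA1
    · calc (A * τ) ^ q⁻¹ * N * log (τ + 1) ^ (-(1 / p))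
          ≤ (A * τ ^ q⁻¹) * N * log (τ + 1) ^ (-(1 / p)) := by
            gcongr
            exact rpow_mul_le_mul_rpow hA1 hτ0.le (inv_le_one_of_one_le₀ hq)
        _ = _ := by ring
  · have hq0 : 0 < q := by linarith
    set N := (eLpNorm φ (ENNReal.ofReal q) volume).toReal with hN
    have hNe : eLpNorm φ (ENNReal.ofReal q) volume = ENNReal.ofReal N :=
      (ENNReal.ofReal_toReal hφ.eLpNorm_ne_top).symm
    rcases (ENNReal.toReal_nonneg : 0 ≤ N).eq_or_lt with h0 | hN0
    · obtain ⟨h1, h2⟩ := hzero p q hq hqp t φ hφ h0.symm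
      exact ⟨h1, h2.le.trans zero_le⟩
    -- Adding `N` to the sup bound ensures `N / M ≤ 1`, and `L = log 2` makes `exp L - 1 = 1`.
    set R := (eLpNorm φ r volume).toReal with hR
    have hRe : eLpNorm φ r volume = ENNReal.ofReal R :=
      (ENNReal.ofReal_toReal hφr.eLpNorm_ne_top).symm
    have hR0 : 0 ≤ R := ENNReal.toReal_nonneg
    set τ := mixedTime s t ^ (-((d : ℝ) / (2 * s))) with hτ
    have hτ0 : 0 < τ := rpow_pos_of_pos (htime t ht) _
    set e := (r⁻¹).toReal with he
    have he1 : e ≤ 1 := by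
      have := ENNReal.toReal_mono ENNReal.one_ne_top (ENNReal.inv_le_one.2 hr)
      rwa [ENNReal.toReal_one] at this
    have hτe : mixedTime s t ^ (-((d : ℝ) / (2 * s) * e)) = τ ^ e := by
      rw [hτ, ← rpow_mul (htime t ht).le, neg_mul]
    have hL : 0 < log 2 := log_pos (by norm_num)
    rw [hNe, hRe, hτe, ← ENNReal.ofReal_mul (by positivity),
      ← ENNReal.ofReal_add (by positivity) hN0.le, ← ENNReal.ofReal_mul (by positivity)]
    refine mixedHeat_memExpLp_of_abs_le hq hqp (hk t ht) hφ (M := (A * τ) ^ e * R + N)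
      (L := log 2) (by positivity) hL (fun x ↦ ?_) ?_ ?_
    · have := (hk t ht).abs_integral_le hr hφr (hconv q hq t ht φ hφ x)
      exact this.trans (le_add_of_nonneg_right hN0.le)
    · rw [exp_log two_pos, ← hN]
      have h1 : N / ((A * τ) ^ e * R + N) ≤ 1 :=
        div_le_one_of_le₀ (le_add_of_nonneg_left (by positivity)) (by positivity)
      have := rpow_le_one (by positivity) h1 hq0.le
      linarith
    · rw [rpow_neg hL.le, ← one_div]
      calc ((A * τ) ^ e * R + N) * (1 / log 2 ^ (1 / p))
          ≤ (A * τ ^ e * R + A * N) * (1 / log 2 ^ (1 / p)) := by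
            gcongr
            · exact rpow_mul_le_mul_rpow hA1 hτ0.le he1
            · exact le_mul_of_one_le_left hN0.le hA1
        _ = _ := by ring
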